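/- Let $F=\{f_1,\ldots,f_n\}\subset\mathbb{C}[x_1,\ldots,x_n]$ be a system of $n$ polynomials in $n$ variables. For a polynomial system in finitely many variables, a point $q$ is called an isolated zero if some ball around $q$ meets the zero set of the system exactly in $q$. The multiplicity of a system at a point $q$ is the dimension over $\mathbb{C}$ of the quotient of the local ring of the polynomial ring at $q$ by the ideal generated by the system. Let $p\in\mathbb{C}^n$ be an isolated singular zero of $F$, i.e. an isolated zero of $F$ at which the Jacobian matrix $J(F)(p)=\bigl(\tfrac{\partial f_i}{\partial x_j}(p)\bigr)_{i,j}$ has rank less than $n$. Let $0\le s<n$ be such that $$\operatorname{rank} J(f_1,\ldots,f_s)(p)=\operatorname{rank} J(F)(p)=s .$$ Consider the augmented system $$G=\{f_1,\ldots,f_n,h_1,\ldots,h_n\}\subset\mathbb{C}[x_1,\ldots,x_n,\alpha_1,\ldots,\alpha_s],\qquad h_j=\sum_{i=1}^{s}\alpha_i\frac{\partial f_i}{\partial x_j}+\frac{\partial f_{s+1}}{\partial x_j}\quad(j=1,\ldots,n).$$ Then: 1. there is a unique $\hat\alpha\in\mathbb{C}^s$ such that $(p,\hat\alpha)$ is an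 isolated zero of $G$; 2. the multiplicity of $G$ at $(p,\hat\alpha)$ is strictly lower than the multiplicity of $F$ at $p$. -/

import Mathlib

open MvPolynomial

noncomputable section

/-- The common zeros in `ℂ^σ` of a polynomial system `F`. -/
def zeroSet {σ ι : Type*} (F : ι → MvPolynomial σ ℂ) : Set (σ → ℂ) :=
  {y | ∀ i, eval y (F i) = 0}

/-- `p` is an isolated zero of `F`: some ball around `p` meets the zero set of `F` exactly in `p`.
(All norms on `ℂ^σ` are equivalent, so the choice of the norm is immaterial.) -/
def IsIsolatedZero {σ ι : Type*} [Fintype σ] (F : ι → MvPolynomial σ ℂ) (p : σ → ℂ) : Prop :=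
  ∃ ε : ℝ, 0 < ε ∧ {y : σ → ℂ | ‖y - p‖ < ε} ∩ zeroSet F = {p}

/-- The Jacobian matrix `(∂ f_i / ∂ x_j)` of `F`, evaluated at `p`. -/
def jacobianAt {σ ι : Type*} (F : ι → MvPolynomial σ ℂ) (p : σ → ℂ) : Matrix ι σ ℂ :=
  Matrix.of fun i j => eval p (pderiv j (F i))

/-- `p` is an isolated singular zero of `F`: an isolated zero at which the rank of the Jacobian
matrix is less than the number of variables. -/
def IsIsolatedSingularZero {σ ι : Type*} [Fintype σ] (F : ι → MvPolynomial σ ℂ)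
    (p : σ → ℂ) : Prop :=
  IsIsolatedZero F p ∧ (jacobianAt F p).rank < Fintype.card σ

/-- The maximal ideal of `ℂ[x]` of all polynomials vanishing at `p`. -/
abbrev pointIdeal {σ : Type*} (p : σ → ℂ) : Ideal (MvPolynomial σ ℂ) :=
  RingHom.ker (eval p)

instance pointIdeal_isPrime {σ : Type*} (p : σ → ℂ) : (pointIdeal p).IsPrime :=
  RingHom.ker_isPrime (eval p)

/-- The local ring `ℂ[x]_p` of `ℂ[x]` at the point `p`. -/
abbrev LocalRingAt {σ : Type*} (p : σ → ℂ) : Type _ :=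
  Localization.AtPrime (pointIdeal p)

/-- The ideal that the system `F` generates in the local ring at `p`. -/
def localIdeal {σ ι : Type*} (F : ι → MvPolynomial σ ℂ) (p : σ → ℂ) : Ideal (LocalRingAt p) :=
  (Ideal.span (Set.range F)).map (algebraMap (MvPolynomial σ ℂ) (LocalRingAt p))

/-- The multiplicity of the system `F` at `p`: the dimension over `ℂ`, as an element of
`ℕ ∪ {∞}`, of the local algebra `ℂ[x]_p / (F)`. -/
def multiplicityAt {σ ι : Type*} (F : ι → MvPolynomial σ ℂ) (p : σ → ℂ) : ℕ∞ :=
  Cardinal.toENat (Module.rank ℂ (LocalRingAt p ⧸ localIdeal F p))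

/-- The augmented system `{f_1, …, f_n, h_1, …, h_n}` in the variables `x_1, …, x_n` (indexed by
`Sum.inl`) and `α_1, …, α_s` (indexed by `Sum.inr`), where
`h_j = α_1 ∂f_1/∂x_j + ⋯ + α_s ∂f_s/∂x_j + ∂f_{s+1}/∂x_j`.
Indices start at `0` here, so `f_{s+1}` is the member of `F` with index `s`. -/
def augmentedSystem {n s : ℕ} (hs : s < n) (F : Fin n → MvPolynomial (Fin n) ℂ) :
    Fin n ⊕ Fin n → MvPolynomial (Fin n ⊕ Fin s) ℂ :=
  Sum.elim
    (fun i => rename Sum.inl (F i))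
    (fun j => (∑ i : Fin s, X (Sum.inr i) * rename Sum.inl (pderiv j (F (Fin.castLE hs.le i))))
      + rename Sum.inl (pderiv j (F ⟨s, hs⟩)))

end

/-! At `p` the equations `h_j = 0` are linear in `α`, and the rank conditions give them exactly one
solution. Zeros of `G` near that point project to zeros of `F` near `p`, hence to `p`, which makes
it isolated.

For the multiplicity, write `O_p` and `O_q` for the local rings at `p` and `q = (p, α)`. By Cramer's
rule each `α_i` is, modulo `G`, a fraction in `x` regular at `p`, so `O_p/(F) → O_q/(G)` is
surjective (`mk_comp_localRename_augmentedSystem_surjective`). The source is finite-dimensional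
because `p` is isolated (`eq_pointIdeal_of_isolated`, by Noether normalization and compactness).
Equal dimensions would make the map injective and yield `a_i` in `O_p` with `∑ a_i ∂_j f_i + ∂_j
f_{s+1}` in `(F)` for all `j`.

This is refuted along a curve (`not_forall_gradient_mem_localIdeal`). The `n - 1` polynomials other
than `f_{s+1}` vanish on a nontrivial formal arc `Φ : O_p → ℂ⟦X⟧`. With `u = Φ(f_{s+1})`, the chain
rule, applied also to the vanishing `Φ(f_i)`, shows that `u` divides `u'`. Since `u` has no constant
term, `u = 0`. Then `Φ` kills `(F)`, which contains a power of the maximal ideal, so the arc is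
trivial.

The arc comes from Krull's height theorem: pass to a one-dimensional quotient domain, dominate it by
a valuation ring, show by a Krull–Akizuki estimate that the maximal ideal of this ring is principal,
and expand in a generator. -/

/-! ### Power series expansions and finiteness of quotients -/

section FormalArcs

open scoped PowerSeries

/-- Expansion with respect to a nonzerodivisor `t` that generates the kernel of a rational point. -/
theorem exists_algHom_powerSeries_of_generator {k V : Type*} [Field k] [CommRing V] [Algebra k V]
    (c : V →ₐ[k] k) (t : V) (ht : ∀ x y, t * x = t * y → x = y) (hct : c t = 0)
    (hker : ∀ x, c x = 0 → t ∣ x) :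
    ∃ φ : V →ₐ[k] k⟦X⟧, φ t = PowerSeries.X := by
  have hex : ∀ x, ∃ y, x = algebraMap k V (c x) + t * y := fun x => by
    obtain ⟨y, hy⟩ := hker (x - algebraMap k V (c x)) (by simp)
    exact ⟨y, by rw [← hy]; ring⟩
  -- `q x` is the difference quotient `(x - c x) / t`; iterating it produces the Taylor coefficients
  -- `c (q^[n] x)`.
  choose q hq using hex
  have quniq : ∀ x (e : k) y, x = algebraMap k V e + t * y → q x = y := by
    intro x e y h
    have he : c x = e := by rw [h]; simp [hct]
    apply ht
    have := hq x
    rw [he] at this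
    exact add_left_cancel (this.symm.trans h)
  have q_add : ∀ x y, q (x + y) = q x + q y := fun x y =>
    quniq _ (c x + c y) _ (by
      conv_lhs => rw [hq x, hq y]
      rw [map_add]; ring)
  -- This twisted Leibniz rule is what makes the expansion multiplicative, coefficient by
  -- coefficient.
  have q_mul : ∀ x y, q (x * y) = algebraMap k V (c x) * q y + q x * y := fun x y =>
    quniq _ (c x * c y) _ (by
      have h1 := hq x
      have h2 := hq y
      rw [map_mul]
      linear_combination y * h1 + algebraMap k V (c x) * h2)
  have q_const : ∀ e, q (algebraMap k V e) = 0 := fun e => quniq _ e _ (by simp)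
  have qn_add : ∀ n x y, q^[n] (x + y) = q^[n] x + q^[n] y := by
    intro n
    induction n with
    | zero => simp
    | succ n ih => intro x y; simp [q_add, ih]
  have q_zero : q 0 = 0 := by simpa using q_const 0
  have qn_zero : ∀ n, q^[n] 0 = 0 := by
    intro n
    induction n with
    | zero => rfl
    | succ n ih => simp [q_zero, ih]
  have q_smul : ∀ (e : k) y, q (algebraMap k V e * y) = algebraMap k V e * q y := fun e y => by
    rw [q_mul, q_const]; simp
  have qn_smul : ∀ n (e : k) y, q^[n] (algebraMap k V e * y) = algebraMap k V e * q^[n] y := by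
    intro n
    induction n with
    | zero => simp
    | succ n ih => intro e y; simp [q_smul, ih]
  let f : V → k⟦X⟧ := fun x => PowerSeries.mk fun n => c (q^[n] x)
  have f_zero : ∀ x, PowerSeries.coeff 0 (f x) = c x := fun x => by simp [f]
  have f_succ : ∀ n x, PowerSeries.coeff (n + 1) (f x) = PowerSeries.coeff n (f (q x)) :=
    fun n x => by simp [f]
  have f_add : ∀ x y, f (x + y) = f x + f y := fun x y => by
    ext n; simp [f, qn_add]
  have f_smul : ∀ (e : k) y, f (algebraMap k V e * y) = PowerSeries.C e * f y := fun e y => by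
    ext n; simp [f, qn_smul]
  have f_exp : ∀ x, f x = PowerSeries.C (c x) + PowerSeries.X * f (q x) := fun x => by
    ext n
    cases n with
    | zero => simp [f_zero]
    | succ n => simp [f_succ, PowerSeries.coeff_succ_X_mul]
  have f_const : ∀ e, f (algebraMap k V e) = PowerSeries.C e := fun e => by
    rw [f_exp, q_const]
    have : f 0 = 0 := by ext n; simp [f, qn_zero]
    simp [this]
  have f_mul : ∀ x y, f (x * y) = f x * f y := by
    suffices ∀ n x y, PowerSeries.coeff n (f (x * y)) = PowerSeries.coeff n (f x * f y) from
      fun x y => PowerSeries.ext fun n => this n x y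
    intro n
    induction n with
    | zero => intro x y; simp [f_zero, PowerSeries.coeff_mul]
    | succ n ih =>
      intro x y
      rw [f_succ, q_mul, f_add, f_smul, map_add, ih, f_exp x, add_mul, map_add, mul_assoc,
        PowerSeries.coeff_succ_X_mul, PowerSeries.coeff_C_mul, PowerSeries.coeff_C_mul, f_succ]
  refine ⟨{ toFun := f, map_one' := ?_, map_mul' := f_mul, map_zero' := ?_, map_add' := f_add,
            commutes' := ?_ }, ?_⟩
  · simpa using f_const 1
  · simpa using f_const 0
  · intro e; exact f_const e
  · change f t = _
    have h1 : q t = 1 := quniq _ 0 _ (by simp)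
    have h2 : f 1 = 1 := by simpa using f_const 1
    rw [f_exp, hct, h1, h2]; simp

/-- If a finite-dimensional `S` fills `B` modulo the `n`-th power of the maximal ideal, then `k·1 +
∑ g S`, over generators `g` of that ideal, fills `B` modulo the next power. -/
theorem IsLocalRing.finite_of_maximalIdeal_pow_eq_bot {k B : Type*} [Field k] [CommRing B]
    [IsLocalRing B] [Algebra k B] (hres : ∀ b : B, ∃ e : k, b - algebraMap k B e ∈ maximalIdeal B)
    (hfg : (maximalIdeal B).FG) {N : ℕ} (hN : maximalIdeal B ^ N = ⊥) : Module.Finite k B := by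
  obtain ⟨G, hG⟩ := hfg
  have key : ∀ n, ∃ S : Submodule k B, S.FG ∧
      ∀ b : B, ∃ s ∈ S, b - s ∈ maximalIdeal B ^ n := by
    intro n
    induction n with
    | zero => exact ⟨⊥, Submodule.fg_bot, fun b => ⟨0, by simp, by simp⟩⟩
    | succ n ih =>
      obtain ⟨S, hS, hSb⟩ := ih
      refine ⟨Submodule.span k {1} ⊔ ⨆ g ∈ G, S.map (LinearMap.mulLeft k g),
        (Submodule.fg_span_singleton _).sup
          (Submodule.fg_biSup _ _ fun g _ => hS.map _), fun b => ?_⟩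
      obtain ⟨e, he⟩ := hres b
      have h2 : ∀ x ∈ maximalIdeal B, ∀ a, ∃ s ∈ ⨆ g ∈ G, S.map (LinearMap.mulLeft k g),
          a * x - s ∈ maximalIdeal B ^ (n + 1) := by
        intro x hx
        rw [← hG] at hx
        induction hx using Submodule.span_induction with
        | mem x hx =>
          intro a
          obtain ⟨s, hs, h⟩ := hSb a
          refine ⟨x * s, Submodule.mem_iSup_of_mem x (Submodule.mem_iSup_of_mem hx ⟨s, hs, rfl⟩), ?_⟩
          have hxm : x ∈ maximalIdeal B := hG ▸ Submodule.subset_span hx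
          have := Ideal.mul_mem_mul h hxm
          rw [← pow_succ] at this
          convert this using 1; ring
        | zero => exact fun _ => ⟨0, zero_mem _, by simp⟩
        | add x y _ _ ihx ihy =>
          intro a
          obtain ⟨s, hs, h⟩ := ihx a
          obtain ⟨s', hs', h'⟩ := ihy a
          exact ⟨s + s', add_mem hs hs', by convert add_mem h h' using 1; ring⟩
        | smul a x hx ihx =>
          intro b
          obtain ⟨s, hs, h⟩ := ihx (b * a)
          exact ⟨s, hs, by rwa [smul_eq_mul, ← mul_assoc]⟩
      obtain ⟨s, hs, h⟩ := h2 _ he 1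
      refine ⟨algebraMap k B e + s, Submodule.add_mem_sup ?_ hs, by convert h using 1; ring⟩
      rw [Algebra.algebraMap_eq_smul_one]
      exact Submodule.smul_mem _ _ (Submodule.mem_span_singleton_self _)
  obtain ⟨S, hS, h⟩ := key N
  refine ⟨(?_ : (⊤ : Submodule k B) = S) ▸ hS⟩
  refine (eq_top_iff.2 fun b _ => ?_).symm
  obtain ⟨s, hs, hb⟩ := h b
  rw [hN, Submodule.mem_bot, sub_eq_zero] at hb
  exact hb ▸ hs

/-- A quotient of a Noetherian local ring with residue field `k` is finite over `k` as soon as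
its only prime ideal is the maximal one. -/
theorem IsLocalRing.finite_quotient_of_forall_prime {k R : Type*} [Field k] [CommRing R]
    [IsLocalRing R] [IsNoetherianRing R] [Algebra k R]
    (hres : ∀ b : R, ∃ e : k, b - algebraMap k R e ∈ maximalIdeal R)
    (I : Ideal R) (hI : ∀ P : Ideal R, P.IsPrime → I ≤ P → P = maximalIdeal R) :
    Module.Finite k (R ⧸ I) ∧ ∃ N, maximalIdeal R ^ N ≤ I := by
  have hrad : maximalIdeal R ≤ I.radical := by
    rw [Ideal.radical_eq_sInf]
    exact le_sInf fun P hP => (hI P hP.2 hP.1).ge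
  obtain ⟨N, hN⟩ := Ideal.exists_pow_le_of_le_radical_of_fg hrad (IsNoetherian.noetherian _)
  refine ⟨?_, N, hN⟩
  by_cases hI1 : I = ⊤
  · subst hI1
    have : Subsingleton (R ⧸ (⊤ : Ideal R)) := Ideal.Quotient.subsingleton_iff.2 rfl
    infer_instance
  have : Nontrivial (R ⧸ I) := Ideal.Quotient.nontrivial_iff.2 hI1
  have hloc : IsLocalRing (R ⧸ I) :=
    IsLocalRing.of_surjective' (Ideal.Quotient.mk I) Ideal.Quotient.mk_surjective
  have hmap : maximalIdeal (R ⧸ I) = (maximalIdeal R).map (Ideal.Quotient.mk I) := by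
    refine ((Ideal.map_eq_top_or_isMaximal_of_surjective _ Ideal.Quotient.mk_surjective
      (maximalIdeal.isMaximal R)).elim (fun h => ?_) fun h => (eq_maximalIdeal h).symm)
    exfalso
    have h1 := (Ideal.eq_top_iff_one _).1 h
    rw [Ideal.mem_map_iff_of_surjective _ Ideal.Quotient.mk_surjective] at h1
    obtain ⟨x, hx, h1⟩ := h1
    have h2 : x - 1 ∈ I := Ideal.Quotient.eq.1 (by simpa using h1)
    have h3 := le_maximalIdeal hI1 h2
    exact (maximalIdeal.isMaximal R).ne_top
      ((Ideal.eq_top_iff_one _).2 (by simpa using sub_mem hx h3))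
  refine IsLocalRing.finite_of_maximalIdeal_pow_eq_bot (N := N) ?_ (IsNoetherian.noetherian _) ?_
  · intro b
    obtain ⟨b, rfl⟩ := Ideal.Quotient.mk_surjective b
    obtain ⟨e, he⟩ := hres b
    refine ⟨e, ?_⟩
    rw [hmap]
    exact Ideal.mem_map_of_mem (Ideal.Quotient.mk I) he
  · rw [hmap, ← Ideal.map_pow, Ideal.map_eq_bot_iff_le_ker, Ideal.mk_ker]
    exact hN

theorem Module.Finite.of_surjective_of_ker_le {k M U W : Type*} [Field k] [AddCommGroup M]
    [AddCommGroup U] [AddCommGroup W] [Module k M] [Module k U] [Module k W] [Module.Finite k U]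
    (f : M →ₗ[k] W) (hf : Function.Surjective f) (g : M →ₗ[k] U)
    (h : LinearMap.ker g ≤ LinearMap.ker f) : Module.Finite k W := by
  have : Module.Finite k (M ⧸ LinearMap.ker g) :=
    Module.Finite.equiv g.quotKerEquivRange.symm
  refine Module.Finite.of_surjective ((LinearMap.ker g).liftQ f h) fun w => ?_
  obtain ⟨x, rfl⟩ := hf w
  exact ⟨Submodule.Quotient.mk x, by simp⟩

/-- The estimate behind the theorem of Krull and Akizuki: if the nonzero ideals of `D` have finite
codimension, then so have the nonzero principal ideals generated by elements of `D` in a domain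
between `D` and its field of fractions. -/
theorem finite_quotient_span_of_birational {k D V : Type*} [Field k] [CommRing D] [IsDomain D]
    [CommRing V] [IsDomain V] [Algebra k D] [Algebra k V] [Algebra D V] [IsScalarTower k D V]
    (hinj : Function.Injective (algebraMap D V))
    (hfrac : ∀ y : V, ∃ b : D, b ≠ 0 ∧ ∃ d : D, algebraMap D V b * y = algebraMap D V d)
    (hfin : ∀ I : Ideal D, I ≠ ⊥ → Module.Finite k (D ⧸ I))
    (a : D) (ha0 : a ≠ 0) (ha : ∀ b : D, b ≠ 0 → ∃ r, b ∣ a ^ r) :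
    Module.Finite k (V ⧸ Ideal.span {algebraMap D V a}) := by
  set α := algebraMap D V a with hα
  have hα0 : α ≠ 0 := fun h => ha0 (hinj (by rw [← hα, h, map_zero]))
  have hfrac' : ∀ y : V, ∃ r, ∃ d : D, α ^ r * y = algebraMap D V d := by
    intro y
    obtain ⟨b, hb, d, hd⟩ := hfrac y
    obtain ⟨r, c, hc⟩ := ha b hb
    exact ⟨r, c * d, by rw [hα, ← map_pow, hc, map_mul, map_mul, ← hd]; ring⟩
  -- The ideals `(α^n V ∩ D) + aD` decrease and contain `a`, so they stabilize because `D/aD` is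
  -- Artinian.
  let I : ℕ → Ideal D := fun n =>
    ((Ideal.span {α ^ n}).comap (algebraMap D V)) ⊔ Ideal.span {a}
  have hI : Antitone I := antitone_nat_of_succ_le fun n => by
    refine sup_le_sup_right (Ideal.comap_mono ?_) _
    rw [Ideal.span_singleton_le_span_singleton]
    exact pow_dvd_pow _ n.le_succ
  have hfa : Module.Finite k (D ⧸ Ideal.span {a}) :=
    hfin _ (by simpa [Ideal.span_singleton_eq_bot] using ha0)
  have hart : IsArtinian D (D ⧸ Ideal.span {a}) := isArtinian_of_tower k inferInstance
  obtain ⟨N, hN⟩ := IsArtinian.monotone_stabilizes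
    (⟨fun n => OrderDual.toDual (Submodule.map (Ideal.span {a}).mkQ (I n)), fun m n h =>
      Submodule.map_mono (hI h)⟩ : ℕ →o (Submodule D (D ⧸ Ideal.span {a}))ᵒᵈ)
  have hstab : ∀ n, N ≤ n → I N = I n := by
    intro n hn
    have h := congrArg (Submodule.comap (Ideal.span {a}).mkQ) (hN n hn)
    have hc : ∀ m, Submodule.comap (Ideal.span {a}).mkQ (Submodule.map (Ideal.span {a}).mkQ (I m))
        = I m := fun m => by
      rw [Submodule.comap_map_mkQ]; exact sup_eq_right.2 le_sup_right
    exact (hc N).symm.trans (h.trans (hc n))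
  -- Modulo `αV`, the denominator of `y` can be lowered to `α^N`: stability writes `d = α^(N+r+1) v
  -- + a e` when `r > 0`, and `y - αv` has a denominator smaller by one factor `α`.
  have hred : ∀ r, ∀ y : V, ∀ d : D, α ^ (N + r) * y = algebraMap D V d →
      ∃ v z, y = z + α * v ∧ ∃ d' : D, α ^ N * z = algebraMap D V d' := by
    intro r
    induction r with
    | zero => intro y d h; exact ⟨0, y, by simp, d, h⟩
    | succ r ih =>
      intro y d h
      have hd : d ∈ I (N + (r + 1)) := Submodule.mem_sup_left (by
        rw [Ideal.mem_comap, ← h]; exact Ideal.mul_mem_right _ _ (Ideal.mem_span_singleton_self _))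
      rw [← hstab _ (by omega), hstab (N + (r + 1) + 1) (by omega)] at hd
      obtain ⟨u, hu, w, hw, huw⟩ := Submodule.mem_sup.1 hd
      obtain ⟨v, hv⟩ := Ideal.mem_span_singleton'.1 (Ideal.mem_comap.1 hu)
      obtain ⟨e, he⟩ := Ideal.mem_span_singleton'.1 hw
      obtain ⟨v', z, hz, hd'⟩ := ih (y - α * v) e (by
        apply mul_left_cancel₀ hα0
        have h2 := congrArg (algebraMap D V) huw
        rw [map_add, ← hv, ← he, map_mul, ← hα] at h2
        rw [← h] at h2
        linear_combination -h2)
      exact ⟨v + v', z, by linear_combination hz, hd'⟩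
  have hfN : Module.Finite k (D ⧸ Ideal.span {a ^ (N + 1)}) :=
    hfin _ (by simpa [Ideal.span_singleton_eq_bot] using ha0)
  -- Pairs `(α^N z, z)`. By `hred` they surject onto `V/αV`. If the first entry is `e a^(N+1)`, then
  -- `z = αe`; so `V/αV` is a quotient of a subspace of `D/a^(N+1)D`.
  let M : Submodule k (D × V) :=
    { carrier := {x | α ^ N * x.2 = algebraMap D V x.1}
      add_mem' := fun {x y} hx hy => by
        simp only [Set.mem_ofPred_eq, Prod.snd_add, Prod.fst_add, map_add, mul_add] at *
        rw [hx, hy]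
      zero_mem' := by simp
      smul_mem' := fun e x hx => by
        simp only [Set.mem_ofPred_eq, Prod.smul_snd, Prod.smul_fst] at *
        rw [mul_smul_comm, hx, ← IsScalarTower.coe_toAlgHom' k D V, map_smul] }
  refine Module.Finite.of_surjective_of_ker_le (M := M)
    ((Ideal.Quotient.mkₐ k (Ideal.span {α})).toLinearMap ∘ₗ LinearMap.snd k D V ∘ₗ M.subtype) ?_
    ((Ideal.Quotient.mkₐ k (Ideal.span {a ^ (N + 1)})).toLinearMap ∘ₗ LinearMap.fst k D V ∘ₗ
      M.subtype) ?_
  · intro y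
    obtain ⟨y, rfl⟩ := Ideal.Quotient.mk_surjective y
    obtain ⟨r, d, hd⟩ := hfrac' y
    obtain ⟨v, z, hz, d', hd'⟩ := hred r y (a ^ N * d) (by
      rw [pow_add, mul_assoc, hd, map_mul, map_pow])
    refine ⟨⟨(d', z), hd'⟩, ?_⟩
    change Ideal.Quotient.mk (Ideal.span {α}) z = _
    rw [Ideal.Quotient.eq, Ideal.mem_span_singleton']
    exact ⟨-v, by rw [hz]; ring⟩
  · rintro ⟨⟨d, z⟩, hd⟩ h
    have h' : d ∈ Ideal.span {a ^ (N + 1)} := Ideal.Quotient.eq_zero_iff_mem.1 h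
    have hd' : α ^ N * z = algebraMap D V d := hd
    obtain ⟨e, rfl⟩ := Ideal.mem_span_singleton'.1 h'
    change Ideal.Quotient.mk (Ideal.span {α}) z = 0
    rw [Ideal.Quotient.eq_zero_iff_mem, Ideal.mem_span_singleton']
    refine ⟨algebraMap D V e, mul_left_cancel₀ (pow_ne_zero N hα0) ?_⟩
    rw [hd', map_mul, map_pow, ← hα]; ring

end FormalArcs

/-! ### Formal arcs through valuation rings -/

section FormalArcs

open scoped PowerSeries
open IsLocalRing

/-- Finiteness of `V/aV` makes the maximal ideal finitely generated, hence principal in a valuation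
ring, and makes the residue field finite over `k`, hence equal to `k`. Expansion in a generator then
applies. -/
theorem ValuationRing.exists_algHom_powerSeries {k V : Type*} [Field k] [IsAlgClosed k]
    [CommRing V] [IsDomain V] [ValuationRing V] [Algebra k V] (a : V) (ha0 : a ≠ 0)
    (ha : a ∈ maximalIdeal V) (hfin : Module.Finite k (V ⧸ Ideal.span {a})) :
    ∃ φ : V →ₐ[k] k⟦X⟧, φ a ≠ 0 := by
  have hle : Ideal.span {a} ≤ maximalIdeal V := (Ideal.span_singleton_le_iff_mem _).2 ha
  have hnoeth : IsNoetherian V (V ⧸ Ideal.span {a}) := isNoetherian_of_tower k inferInstance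
  have hfg : (maximalIdeal V).FG := by
    refine Submodule.fg_of_fg_map_of_fg_inf_ker (Ideal.span {a}).mkQ
      (IsNoetherian.noetherian _) ?_
    rw [Submodule.ker_mkQ, inf_eq_right.2 hle]
    exact ⟨{a}, by simp⟩
  obtain ⟨t, ht⟩ := (IsBezout.isPrincipal_of_FG _ hfg).principal
  have htm : t ∈ maximalIdeal V := ht ▸ Submodule.mem_span_singleton_self t
  have hta : t ∣ a := by
    rw [ht] at ha
    exact Ideal.mem_span_singleton.1 ha
  have ht0 : t ≠ 0 := by
    rintro rfl
    exact ha0 (zero_dvd_iff.1 hta)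
  have hfinres : Module.Finite k (V ⧸ maximalIdeal V) :=
    Module.Finite.of_surjective (Ideal.Quotient.factorₐ k hle).toLinearMap
      (Ideal.Quotient.factor_surjective hle)
  have hbij : Function.Bijective (algebraMap k (V ⧸ maximalIdeal V)) :=
    IsAlgClosed.algebraMap_bijective_of_isIntegral
  let c : V →ₐ[k] k := ((AlgEquiv.ofBijective (Algebra.ofId k (V ⧸ maximalIdeal V))
    hbij).symm : (V ⧸ maximalIdeal V) →ₐ[k] k).comp (Ideal.Quotient.mkₐ k _)
  have hc : ∀ x, c x = 0 ↔ x ∈ maximalIdeal V := fun x => by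
    simp [c, Ideal.Quotient.eq_zero_iff_mem]
  obtain ⟨φ, hφ⟩ := exists_algHom_powerSeries_of_generator c t
    (fun x y h => mul_left_cancel₀ ht0 h) ((hc t).2 htm) (fun x hx => by
      have := (hc x).1 hx
      rw [ht] at this
      exact Ideal.mem_span_singleton.1 this)
  refine ⟨φ, fun h0 => ?_⟩
  -- The powers of `(t)` stabilize modulo `a`, so `t^N` lies in `(t^(N+1)) + (a)`. If `φ a = 0`,
  -- then `X^N` would be a multiple of `X^(N+1)`.
  have hart : IsArtinian V (V ⧸ Ideal.span {a}) := isArtinian_of_tower k inferInstance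
  obtain ⟨N, hN⟩ := IsArtinian.monotone_stabilizes
    (⟨fun n => OrderDual.toDual (Submodule.map (Ideal.span {a}).mkQ (Ideal.span {t ^ n})),
      fun m n h => Submodule.map_mono (Ideal.span_singleton_le_span_singleton.2 (pow_dvd_pow t h))⟩
        : ℕ →o (Submodule V (V ⧸ Ideal.span {a}))ᵒᵈ)
  have h1 : (Ideal.span {a}).mkQ (t ^ N) ∈
      Submodule.map (Ideal.span {a}).mkQ (Ideal.span {t ^ (N + 1)}) := by
    have h := hN (N + 1) N.le_succ
    have h' : Submodule.map (Ideal.span {a}).mkQ (Ideal.span {t ^ N}) =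
      Submodule.map (Ideal.span {a}).mkQ (Ideal.span {t ^ (N + 1)}) := h
    rw [← h']
    exact Submodule.mem_map_of_mem (Ideal.mem_span_singleton_self _)
  obtain ⟨y, hy, hyt⟩ := h1
  obtain ⟨u, rfl⟩ := Ideal.mem_span_singleton'.1 hy
  have h2 : u * t ^ (N + 1) - t ^ N ∈ Ideal.span {a} := (Submodule.Quotient.eq _).1 hyt
  obtain ⟨w, hw⟩ := Ideal.mem_span_singleton'.1 h2
  have h3 := congrArg φ hw
  rw [map_mul, h0, mul_zero, map_sub, map_mul, map_pow, map_pow, hφ] at h3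
  have h4 := congrArg (PowerSeries.coeff N) h3
  rw [map_sub, PowerSeries.coeff_mul_X_pow', PowerSeries.coeff_X_pow_self] at h4
  simp at h4

/-- A one-dimensional Noetherian local domain with algebraically closed residue field `k` has a
nontrivial formal arc. -/
theorem exists_algHom_powerSeries_of_dimension_one {k D : Type*} [Field k] [IsAlgClosed k]
    [CommRing D] [IsDomain D] [IsLocalRing D] [IsNoetherianRing D] [Algebra k D]
    (hres : ∀ b : D, ∃ e : k, b - algebraMap k D e ∈ maximalIdeal D)
    (hdim : ∀ P : Ideal D, P.IsPrime → P ≠ ⊥ → P = maximalIdeal D)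
    (a : D) (ha0 : a ≠ 0) (ha : a ∈ maximalIdeal D) :
    ∃ φ : D →ₐ[k] k⟦X⟧, φ a ≠ 0 := by
  have hq : ∀ I : Ideal D, I ≠ ⊥ → Module.Finite k (D ⧸ I) ∧ ∃ N, maximalIdeal D ^ N ≤ I :=
    fun I hI => IsLocalRing.finite_quotient_of_forall_prime hres I fun P hP hle =>
      hdim P hP fun h => hI (le_bot_iff.1 (h ▸ hle))
  -- `A` dominates `D` inside the fraction field. It is not known to be Noetherian; the birational
  -- estimate supplies the finiteness needed.
  obtain ⟨A, hA, hloc⟩ := IsLocalRing.exists_factor_valuationRing (algebraMap D (FractionRing D))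
  let _ : Algebra D A := ((algebraMap D (FractionRing D)).codRestrict A.toSubring hA).toAlgebra
  let _ : Algebra k A := ((algebraMap D A).comp (algebraMap k D)).toAlgebra
  have : IsScalarTower k D A := IsScalarTower.of_algebraMap_eq fun _ => rfl
  have hval : ∀ d : D, ((algebraMap D A d : A) : FractionRing D) = algebraMap D _ d := fun _ => rfl
  have hinj : Function.Injective (algebraMap D A) := fun x y h =>
    IsFractionRing.injective D (FractionRing D) (by rw [← hval, ← hval, h])
  obtain ⟨φ, hφ⟩ := ValuationRing.exists_algHom_powerSeries (k := k) (algebraMap D A a)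
    (fun h => ha0 (hinj (by rw [h, map_zero])))
    ((mem_maximalIdeal _).2 fun h => (mem_maximalIdeal _).1 ha (hloc.map_nonunit _ h))
    (finite_quotient_span_of_birational hinj (fun y => by
      obtain ⟨d, b, hb, h⟩ := IsFractionRing.div_surjective (A := D) (y : FractionRing D)
      refine ⟨b, nonZeroDivisors.ne_zero hb, d, Subtype.ext ?_⟩
      change algebraMap D (FractionRing D) b * (y : FractionRing D) = algebraMap D _ d
      have hb' : algebraMap D (FractionRing D) b ≠ 0 := IsFractionRing.to_map_ne_zero_of_mem_nonZeroDivisors hb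
      rw [← h]; field_simp) (fun I hI => (hq I hI).1) a ha0 fun b hb => by
        obtain ⟨N, hN⟩ := (hq (Ideal.span {b}) (by simpa [Ideal.span_singleton_eq_bot] using hb)).2
        exact ⟨N, Ideal.mem_span_singleton.1 (hN (Ideal.pow_mem_pow ha N))⟩)
  exact ⟨φ.comp (IsScalarTower.toAlgHom k D A), hφ⟩

/-- An ideal of a Noetherian local ring that is not primary to the maximal ideal is killed by
a nontrivial formal arc. -/
theorem exists_algHom_powerSeries_of_notMem_minimalPrimes {k R : Type*} [Field k] [IsAlgClosed k]
    [CommRing R] [IsLocalRing R] [IsNoetherianRing R] [Algebra k R]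
    (hres : ∀ b : R, ∃ e : k, b - algebraMap k R e ∈ maximalIdeal R)
    (J : Ideal R) (hJ : J ≤ maximalIdeal R) (hmin : maximalIdeal R ∉ J.minimalPrimes) :
    ∃ φ : R →ₐ[k] k⟦X⟧, (∀ x ∈ J, φ x = 0) ∧ ∃ a ∈ maximalIdeal R, φ a ≠ 0 := by
  obtain ⟨P, hP, hPm⟩ := Ideal.exists_minimalPrimes_le hJ
  have hPne : P < maximalIdeal R := lt_of_le_of_ne hPm fun h => hmin (h ▸ hP)
  -- A prime as large as possible strictly below the maximal ideal: `R/Q` is then one-dimensional.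
  obtain ⟨Q, ⟨hQp, hJQ, hQm⟩, hQmax⟩ := set_has_maximal_iff_noetherian.2 ‹IsNoetherian R R›
    {Q : Ideal R | Q.IsPrime ∧ J ≤ Q ∧ Q < maximalIdeal R} ⟨P, hP.1.1, hP.1.2, hPne⟩
  obtain ⟨a, ha, haQ⟩ := SetLike.exists_of_lt hQm
  have hloc : IsLocalRing (R ⧸ Q) :=
    IsLocalRing.of_surjective' (Ideal.Quotient.mk Q) Ideal.Quotient.mk_surjective
  have hcomap : (maximalIdeal (R ⧸ Q)).comap (Ideal.Quotient.mk Q) = maximalIdeal R :=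
    eq_maximalIdeal (Ideal.comap_isMaximal_of_surjective _ Ideal.Quotient.mk_surjective)
  have hmem : ∀ x, Ideal.Quotient.mk Q x ∈ maximalIdeal (R ⧸ Q) ↔ x ∈ maximalIdeal R := fun x => by
    rw [← hcomap, Ideal.mem_comap]
  obtain ⟨φ, hφ⟩ := exists_algHom_powerSeries_of_dimension_one (k := k) (D := R ⧸ Q)
    (fun b => by
      obtain ⟨b, rfl⟩ := Ideal.Quotient.mk_surjective b
      obtain ⟨e, he⟩ := hres b
      exact ⟨e, (hmem _).2 he⟩)
    (fun P' hP' hne => by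
      by_contra hne'
      have hlt : Q < P'.comap (Ideal.Quotient.mk Q) := by
        refine lt_of_le_of_ne (fun x hx => ?_) fun h => hne ?_
        · rw [Ideal.mem_comap, Ideal.Quotient.eq_zero_iff_mem.2 hx]; exact zero_mem _
        · rw [← Ideal.map_comap_of_surjective _ Ideal.Quotient.mk_surjective P', ← h,
            Ideal.map_quotient_self]
      refine hQmax (P'.comap (Ideal.Quotient.mk Q)) ⟨inferInstance, hJQ.trans hlt.le, ?_⟩ hlt
      refine lt_of_le_of_ne (le_maximalIdeal (Ideal.IsPrime.ne_top inferInstance)) fun h => hne' ?_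
      rw [← Ideal.map_comap_of_surjective _ Ideal.Quotient.mk_surjective P', h, ← hcomap,
        Ideal.map_comap_of_surjective _ Ideal.Quotient.mk_surjective])
    (Ideal.Quotient.mk Q a) (fun h => haQ (Ideal.Quotient.eq_zero_iff_mem.1 h)) ((hmem a).2 ha)
  refine ⟨φ.comp (Ideal.Quotient.mkₐ k Q), fun x hx => ?_, a, ha, hφ⟩
  have : Ideal.Quotient.mk Q x = 0 := Ideal.Quotient.eq_zero_iff_mem.2 (hJQ hx)
  simp [this]

end FormalArcs

/-! ### The local ring of affine space at a point -/

section LocalRing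

open scoped PowerSeries
open IsLocalRing

/-- The kernels of the substitutions `x_j ↦ p_j` for the first `i` variables form a strict chain of
primes, `i = 0, …, n`. -/
theorem natCast_le_height_pointIdeal {n : ℕ} (p : Fin n → ℂ) : (n : ℕ∞) ≤ (pointIdeal p).height := by
  let ψ : ℕ → MvPolynomial (Fin n) ℂ →ₐ[ℂ] MvPolynomial (Fin n) ℂ := fun i =>
    aeval fun j => if (j : ℕ) < i then C (p j) else X j
  have hψ : ∀ i, (ψ i).comp (ψ i) = ψ i := fun i => by
    ext j
    by_cases h : (j : ℕ) < i <;> simp [ψ, h, ← algebraMap_eq]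
  have hψ' : ∀ i, (ψ (i + 1)).comp (ψ i) = ψ (i + 1) := fun i => by
    ext j
    by_cases h : (j : ℕ) < i
    · simp [ψ, h, h.le, ← algebraMap_eq]
    · simp [ψ, h]
  let Q : ℕ → Ideal (MvPolynomial (Fin n) ℂ) := fun i => RingHom.ker (ψ i)
  have hQ : ∀ i, (Q i).IsPrime := fun i => RingHom.ker_isPrime _
  have hlt : ∀ i, i < n → Q i < Q (i + 1) := by
    intro i hi
    refine SetLike.lt_iff_le_and_exists.2 ⟨fun x hx => ?_, X ⟨i, hi⟩ - C (p ⟨i, hi⟩), ?_, ?_⟩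
    · rw [RingHom.mem_ker] at hx ⊢
      rw [← hψ', AlgHom.comp_apply]
      rw [show ψ i x = 0 from hx, map_zero]
    · rw [RingHom.mem_ker]
      simp [ψ, ← algebraMap_eq]
    · rw [RingHom.mem_ker]
      intro h
      have := congrArg (eval fun j => p j + 1) h
      simp [ψ, ← algebraMap_eq] at this
  have hh : ∀ i, i ≤ n → (i : ℕ∞) ≤ (Q i).height := by
    intro i
    induction i with
    | zero => simp
    | succ i ih =>
      intro hi
      rw [Nat.cast_succ]
      exact (add_le_add_left (ih (by omega)) 1).trans
        (Ideal.height_add_one_le_of_lt_of_isPrime (hlt i (by omega)))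
  refine (hh n le_rfl).trans (Ideal.height_mono fun x hx => ?_)
  rw [RingHom.mem_ker] at hx ⊢
  have h1 : (eval p).comp (ψ n : MvPolynomial (Fin n) ℂ →+* MvPolynomial (Fin n) ℂ) = eval p := by
    refine MvPolynomial.ringHom_ext (fun _ => by simp [ψ, ← algebraMap_eq]) fun j => by simp [ψ]
  rw [← h1, RingHom.comp_apply]
  rw [show (ψ n : MvPolynomial (Fin n) ℂ →+* MvPolynomial (Fin n) ℂ) x = 0 from hx, map_zero]

theorem exists_sub_algebraMap_mem_maximalIdeal {σ : Type*} (p : σ → ℂ) (b : LocalRingAt p) :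
    ∃ e : ℂ, b - algebraMap ℂ (LocalRingAt p) e ∈ maximalIdeal (LocalRingAt p) := by
  obtain ⟨x, y, rfl⟩ := IsLocalization.exists_mk'_eq (pointIdeal p).primeCompl b
  have hy : eval p (y : MvPolynomial σ ℂ) ≠ 0 := fun h => y.2 h
  refine ⟨eval p x / eval p (y : MvPolynomial σ ℂ), ?_⟩
  have h1 : IsLocalization.mk' (LocalRingAt p) x y -
      algebraMap ℂ (LocalRingAt p) (eval p x / eval p (y : MvPolynomial σ ℂ)) =
      IsLocalization.mk' (LocalRingAt p) (x - C (eval p x / eval p (y : MvPolynomial σ ℂ)) * (y : MvPolynomial σ ℂ)) y := by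
    rw [IsLocalization.eq_mk'_iff_mul_eq, sub_mul, IsLocalization.mk'_spec, map_sub, map_mul,
      IsScalarTower.algebraMap_apply ℂ (MvPolynomial σ ℂ) (LocalRingAt p), algebraMap_eq]
  rw [h1, IsLocalization.AtPrime.mk'_mem_maximal_iff _ (pointIdeal p), RingHom.mem_ker]
  simp [hy]

/-- By Krull's height theorem, an ideal with fewer than `n` generators cannot have the maximal
ideal, of height at least `n`, as a minimal prime. -/
theorem exists_arc_of_card_lt {n : ℕ} (p : Fin n → ℂ) (S : Set (LocalRingAt p)) (hS : S.Finite)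
    (hcard : S.ncard < n) (hSm : ∀ x ∈ S, x ∈ maximalIdeal (LocalRingAt p)) :
    ∃ φ : LocalRingAt p →ₐ[ℂ] ℂ⟦X⟧, (∀ x ∈ S, φ x = 0) ∧
      ∃ a ∈ maximalIdeal (LocalRingAt p), φ a ≠ 0 := by
  have : IsNoetherianRing (LocalRingAt p) :=
    IsLocalization.isNoetherianRing (pointIdeal p).primeCompl _ inferInstance
  obtain ⟨φ, h, h'⟩ := exists_algHom_powerSeries_of_notMem_minimalPrimes (k := ℂ)
    (exists_sub_algebraMap_mem_maximalIdeal p) (Ideal.span S) (Ideal.span_le.2 hSm) (fun hmin => by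
      have h1 := Ideal.height_le_card_of_mem_minimalPrimes_span hS hmin
      have h2 := natCast_le_height_pointIdeal p
      have h3 : ((pointIdeal p).height : WithBot ℕ∞) = (maximalIdeal (LocalRingAt p)).height := by
        rw [IsLocalRing.maximalIdeal_height_eq_ringKrullDim,
          IsLocalization.AtPrime.ringKrullDim_eq_height (pointIdeal p)]
      rw [WithBot.coe_inj.1 h3] at h2
      exact absurd (Nat.cast_le.1 (h2.trans h1)) (by omega))
  exact ⟨φ, fun x hx => h x (Ideal.subset_span hx), h'⟩

theorem finite_quotient_localIdeal {σ ι : Type*} [Finite σ] (F : ι → MvPolynomial σ ℂ) (p : σ → ℂ)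
    (hF : ∀ P : Ideal (MvPolynomial σ ℂ), P.IsPrime → P ≤ pointIdeal p → (∀ i, F i ∈ P) →
      P = pointIdeal p) :
    Module.Finite ℂ (LocalRingAt p ⧸ localIdeal F p) ∧
      ∃ N, maximalIdeal (LocalRingAt p) ^ N ≤ localIdeal F p := by
  have : IsNoetherianRing (LocalRingAt p) :=
    IsLocalization.isNoetherianRing (pointIdeal p).primeCompl _ inferInstance
  refine IsLocalRing.finite_quotient_of_forall_prime
    (exists_sub_algebraMap_mem_maximalIdeal p) _ fun P hP hle => ?_
  have h1 : P.comap (algebraMap (MvPolynomial σ ℂ) (LocalRingAt p)) = pointIdeal p := by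
    refine hF _ inferInstance ?_ fun i => ?_
    · exact (Ideal.comap_mono (le_maximalIdeal hP.ne_top)).trans
        (IsLocalization.AtPrime.under_maximalIdeal (LocalRingAt p) (pointIdeal p)).le
    · exact hle (Ideal.mem_map_of_mem _ (Ideal.subset_span ⟨i, rfl⟩))
  rw [← IsLocalization.map_under (pointIdeal p).primeCompl (LocalRingAt p) P]
  change Ideal.map _ (P.comap _) = _
  rw [h1, Localization.AtPrime.map_eq_maximalIdeal]

end LocalRing

/-! ### Isolated points in the Euclidean topology -/

section IsolatedZeros

open Filter Topology

theorem Multiset.exists_norm_pow_card_le_norm_prod {s : Multiset ℂ} (hs : s ≠ 0) :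
    ∃ z ∈ s, ‖z‖ ^ s.card ≤ ‖s.prod‖ := by
  induction s using Multiset.induction_on with
  | empty => exact absurd rfl hs
  | cons a t ih =>
    by_cases ht : t = 0
    · subst ht; exact ⟨a, by simp, by simp⟩
    obtain ⟨z, hz, hle⟩ := ih ht
    rw [Multiset.card_cons, Multiset.prod_cons, norm_mul]
    rcases le_total ‖a‖ ‖z‖ with h | h
    · refine ⟨a, Multiset.mem_cons_self _ _, ?_⟩
      rw [pow_succ, mul_comm]
      exact mul_le_mul_of_nonneg_left ((pow_le_pow_left₀ (norm_nonneg _) h _).trans hle)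
        (norm_nonneg _)
    · refine ⟨z, Multiset.mem_cons_of_mem hz, ?_⟩
      rw [pow_succ, mul_comm]
      exact mul_le_mul h hle (by positivity) (norm_nonneg _)

/-- The constant coefficient is, up to sign, the product of the roots; a root of least modulus
works. -/
theorem Polynomial.Monic.exists_isRoot_norm_pow_le {q : Polynomial ℂ} (hq : q.Monic)
    (hdeg : q.natDegree ≠ 0) : ∃ z, q.IsRoot z ∧ ‖z‖ ^ q.natDegree ≤ ‖q.coeff 0‖ := by
  have hs : q.Splits := IsAlgClosed.splits q
  have hcard := hs.natDegree_eq_card_roots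
  obtain ⟨z, hz, hle⟩ := Multiset.exists_norm_pow_card_le_norm_prod (s := q.roots) (by
    intro h; rw [h] at hcard; exact hdeg (by simpa using hcard))
  refine ⟨z, Polynomial.isRoot_of_mem_roots hz, ?_⟩
  rw [hs.coeff_zero_eq_prod_roots_of_monic hq, norm_mul]
  simpa [hcard] using hle

/-- Lying over gives a maximal ideal of `A`, whose residue field is `ℂ` by the Nullstellensatz. -/
theorem exists_algHom_lift_of_isIntegral {C A : Type*} [CommRing C] [CommRing A] [Algebra ℂ C]
    [Algebra ℂ A] [Algebra.FiniteType ℂ A] (f : C →ₐ[ℂ] A) (hf : f.IsIntegral) (c : C →ₐ[ℂ] ℂ)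
    (hker : RingHom.ker f ≤ RingHom.ker c) : ∃ y : A →ₐ[ℂ] ℂ, y.comp f = c := by
  let _ : Algebra C A := f.toRingHom.toAlgebra
  have : Algebra.IsIntegral C A := ⟨hf⟩
  have hmax : (RingHom.ker c).IsMaximal :=
    RingHom.ker_isMaximal_of_surjective c fun e => ⟨algebraMap ℂ C e, by simp⟩
  obtain ⟨Q, hQ, hQc⟩ := Ideal.exists_ideal_over_maximal_of_isIntegral (S := A) (RingHom.ker c) hker
  let _ : Field (A ⧸ Q) := Ideal.Quotient.field Q
  have : Module.Finite ℂ (A ⧸ Q) := finite_of_finite_type_of_isJacobsonRing ℂ (A ⧸ Q)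
  have hbij : Function.Bijective (algebraMap ℂ (A ⧸ Q)) :=
    IsAlgClosed.algebraMap_bijective_of_isIntegral
  let y : A →ₐ[ℂ] ℂ := ((AlgEquiv.ofBijective (Algebra.ofId ℂ (A ⧸ Q))
    hbij).symm : (A ⧸ Q) →ₐ[ℂ] ℂ).comp (Ideal.Quotient.mkₐ ℂ _)
  have hy : ∀ a ∈ Q, y a = 0 := fun a ha => by
    simp [y, Ideal.Quotient.eq_zero_iff_mem.2 ha]
  refine ⟨y, AlgHom.ext fun x => ?_⟩
  have h1 : x - algebraMap ℂ C (c x) ∈ RingHom.ker c := by simp [RingHom.mem_ker]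
  rw [← hQc, Ideal.mem_comap] at h1
  have h2 := hy _ h1
  change y (f (x - algebraMap ℂ C (c x))) = 0 at h2
  rw [map_sub, map_sub, AlgHom.commutes, AlgHom.commutes, sub_eq_zero] at h2
  exact h2

variable {d : ℕ} {A : Type*} [CommRing A] [Algebra ℂ A]

/-- Forces, over each `β` near the image of `x`, a point where `G` is small. Here `b` is the
constant coefficient of the minimal polynomial of `G`. As the polynomial ring is integrally closed,
that polynomial generates all relations of `G`, so every root of its specialization at `β` is a
value of `G` over `β`. -/
theorem exists_point_over_norm_le [IsDomain A] [Algebra.FiniteType ℂ A]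
    (g : MvPolynomial (Fin d) ℂ →ₐ[ℂ] A)
    (ginj : Function.Injective g) (gint : g.IsIntegral) (x : A →ₐ[ℂ] ℂ) (G : A) (hG : x G = 0) :
    ∃ m : ℕ, m ≠ 0 ∧ ∃ b : MvPolynomial (Fin d) ℂ, x (g b) = 0 ∧ ∀ β : Fin d → ℂ,
      ∃ y : A →ₐ[ℂ] ℂ, y.comp g = aeval β ∧ ‖y G‖ ^ m ≤ ‖eval β b‖ := by
  let _ : Algebra (MvPolynomial (Fin d) ℂ) A := g.toRingHom.toAlgebra
  have hg : algebraMap (MvPolynomial (Fin d) ℂ) A = g.toRingHom := rfl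
  have : IsScalarTower ℂ (MvPolynomial (Fin d) ℂ) A :=
    IsScalarTower.of_algebraMap_eq fun r => (g.commutes r).symm
  have hfaith : FaithfulSMul (MvPolynomial (Fin d) ℂ) A :=
    (faithfulSMul_iff_algebraMap_injective _ _).2 ginj
  have : Module.IsTorsionFree (MvPolynomial (Fin d) ℂ) A := inferInstance
  have hGi : IsIntegral (MvPolynomial (Fin d) ℂ) G := gint G
  set μ := minpoly (MvPolynomial (Fin d) ℂ) G with hμ
  have hmonic : μ.Monic := minpoly.monic hGi
  refine ⟨μ.natDegree, (minpoly.natDegree_pos hGi).ne', μ.coeff 0, ?_, fun β => ?_⟩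
  · have h := congrArg x (minpoly.aeval (MvPolynomial (Fin d) ℂ) G)
    rw [map_zero, ← hμ, ← Polynomial.divX_mul_X_add μ, map_add, map_add, map_mul, map_mul,
      Polynomial.aeval_X, hG, mul_zero, zero_add, Polynomial.aeval_C] at h
    exact h
  · obtain ⟨γ, hγ, hle⟩ := (hmonic.map (eval β)).exists_isRoot_norm_pow_le (by
      rw [hmonic.natDegree_map]; exact (minpoly.natDegree_pos hGi).ne')
    rw [hmonic.natDegree_map, Polynomial.coeff_map] at hle
    let f : Polynomial (MvPolynomial (Fin d) ℂ) →ₐ[ℂ] A :=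
      (Polynomial.aeval G : Polynomial (MvPolynomial (Fin d) ℂ) →ₐ[_] A).restrictScalars ℂ
    let c : Polynomial (MvPolynomial (Fin d) ℂ) →ₐ[ℂ] ℂ :=
      { Polynomial.eval₂RingHom (eval β) γ with
        commutes' := fun r => by
          simp [IsScalarTower.algebraMap_apply ℂ (MvPolynomial (Fin d) ℂ), algebraMap_eq] }
    have hc : ∀ q, c q = q.eval₂ (eval β) γ := fun q => rfl
    obtain ⟨y, hy⟩ := exists_algHom_lift_of_isIntegral f
      (RingHom.IsIntegral.tower_top Polynomial.C f.toRingHom (by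
        have : f.toRingHom.comp Polynomial.C = g.toRingHom := by
          refine RingHom.ext fun q => ?_
          simp [f, hg]
        rw [this]; exact gint)) c (fun q hq => by
        have hq' : μ ∣ q := (minpoly.isIntegrallyClosed_dvd_iff hGi q).1 hq
        obtain ⟨r, rfl⟩ := hq'
        rw [RingHom.mem_ker, map_mul]
        have : c μ = 0 := by rw [hc, ← Polynomial.eval_map]; exact hγ
        rw [this, zero_mul])
    refine ⟨y, ?_, ?_⟩
    · ext i
      have h := DFunLike.congr_fun hy (Polynomial.C (X i))
      rw [hc] at h
      simpa [f, hg] using h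
    · have h := DFunLike.congr_fun hy Polynomial.X
      rw [hc] at h
      have h' : y G = γ := by simpa [f] using h
      rw [h']; exact hle

theorem exists_monic_forall_isRoot (g : MvPolynomial (Fin d) ℂ →ₐ[ℂ] A) (gint : g.IsIntegral)
    (a : A) : ∃ q : Polynomial (MvPolynomial (Fin d) ℂ), q.Monic ∧
      ∀ (y : A →ₐ[ℂ] ℂ) (β : Fin d → ℂ), y.comp g = aeval β → (q.map (eval β)).IsRoot (y a) := by
  obtain ⟨q, hq, h⟩ := gint a
  refine ⟨q, hq, fun y β hy => ?_⟩
  have h1 := congrArg y h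
  rw [map_zero] at h1
  rw [Polynomial.IsRoot, Polynomial.eval_map]
  have h2 : (y : A →+* ℂ).comp (g : MvPolynomial (Fin d) ℂ →+* A) = eval β := by
    refine RingHom.ext fun b => (DFunLike.congr_fun hy b).trans ?_
    rw [aeval_eq_eval]
  rw [← h2, ← h1]
  exact (Polynomial.hom_eval₂ q (g : MvPolynomial (Fin d) ℂ →+* A) (y : A →+* ℂ) a).symm

/-- Cauchy's root bound for an integral equation of `a`, whose coefficients are bounded on the
compact ball. -/
theorem exists_norm_le_of_isIntegral (g : MvPolynomial (Fin d) ℂ →ₐ[ℂ] A) (gint : g.IsIntegral)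
    (a : A) (β₀ : Fin d → ℂ) : ∃ K : ℝ, ∀ β ∈ Metric.closedBall β₀ 1, ∀ y : A →ₐ[ℂ] ℂ,
      y.comp g = aeval β → ‖y a‖ ≤ K := by
  obtain ⟨q, hq, h⟩ := exists_monic_forall_isRoot g gint a
  have hM : ∀ i, ∃ M : NNReal, ∀ β ∈ Metric.closedBall β₀ 1, ‖eval β (q.coeff i)‖₊ ≤ M := fun i => by
    obtain ⟨M, hM⟩ := (isCompact_closedBall β₀ 1).exists_bound_of_continuousOn
      (continuous_eval (q.coeff i)).continuousOn
    exact ⟨M.toNNReal, fun β hβ => by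
      rw [← NNReal.coe_le_coe, coe_nnnorm]
      exact (hM β hβ).trans (Real.le_coe_toNNReal M)⟩
  choose M hM using hM
  refine ⟨((∑ i ∈ Finset.range q.natDegree, M i + 1 : NNReal) : ℝ), fun β hβ y hy => ?_⟩
  have h1 := (h y β hy).norm_lt_cauchyBound (hq.map _).ne_zero
  rw [← coe_nnnorm, NNReal.coe_le_coe]
  refine h1.le.trans ?_
  rw [Polynomial.cauchyBound, (hq.map (eval β)).leadingCoeff, nnnorm_one, div_one]
  refine add_le_add_left (Finset.sup_le fun i hi => ?_) 1
  rw [hq.natDegree_map] at hi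
  rw [Polynomial.coeff_map]
  exact (hM i β hβ).trans (Finset.single_le_sum (f := M) (fun _ _ => zero_le) hi)

theorem finite_points_over [Algebra.FiniteType ℂ A] (g : MvPolynomial (Fin d) ℂ →ₐ[ℂ] A)
    (gint : g.IsIntegral) (β : Fin d → ℂ) : {y : A →ₐ[ℂ] ℂ | y.comp g = aeval β}.Finite := by
  obtain ⟨s, hs⟩ := Algebra.FiniteType.out (R := ℂ) (A := A)
  choose q hq h using fun a => exists_monic_forall_isRoot g gint a
  refine Set.Finite.of_finite_image (f := fun y (a : s) => y (a : A)) ?_ fun y _ z _ hyz => ?_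
  · refine (Set.Finite.pi (t := fun a : s => {z | ((q a).map (eval β)).IsRoot z}) fun a =>
      Polynomial.finite_setOfPred_isRoot ((hq a).map _).ne_zero).subset ?_
    rintro _ ⟨y, hy, rfl⟩ a _
    exact h a y β hy
  · exact AlgHom.ext_of_adjoin_eq_top hs fun a ha => congrFun hyz ⟨a, ha⟩

theorem exists_separating_element {x : A →ₐ[ℂ] ℂ} {S : Set (A →ₐ[ℂ] ℂ)} (hS : S.Finite) :
    ∃ G : A, x G = 0 ∧ ∀ y ∈ S, y G = 0 → y = x := by
  classical
  have hex : ∀ y : A →ₐ[ℂ] ℂ, y ≠ x → ∃ a, y a ≠ x a := fun y hy => by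
    by_contra! h; exact hy (AlgHom.ext h)
  choose! a ha using hex
  let u : A := ∏ y ∈ hS.toFinset.erase x, (a y - algebraMap ℂ A (y (a y)))
  have hxu : x u ≠ 0 := by
    rw [map_prod, Finset.prod_ne_zero_iff]
    intro y hy
    rw [map_sub, AlgHom.commutes, sub_ne_zero]
    exact (ha y (Finset.ne_of_mem_erase hy)).symm
  refine ⟨u - algebraMap ℂ A (x u), by simp, fun y hy h => ?_⟩
  by_contra hne
  have hyu : y u = 0 := by
    rw [map_prod]
    refine Finset.prod_eq_zero (Finset.mem_erase.2 ⟨hne, hS.mem_toFinset.2 hy⟩) ?_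
    simp
  rw [map_sub, hyu, AlgHom.commutes] at h
  exact hxu (by simpa using h)

/-- In the Euclidean topology, a point of an affine variety of positive dimension is not
isolated. -/
theorem eq_pointIdeal_of_isolated {n : ℕ} (p : Fin n → ℂ) (P : Ideal (MvPolynomial (Fin n) ℂ))
    [hP : P.IsPrime] (hle : P ≤ pointIdeal p) (ε : ℝ) (hε : 0 < ε)
    (hiso : ∀ y : Fin n → ℂ, ‖y - p‖ < ε → (∀ f ∈ P, eval y f = 0) → y = p) :
    P = pointIdeal p := by
  let A := MvPolynomial (Fin n) ℂ ⧸ P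
  obtain ⟨d, g, ginj, gint⟩ := exists_integral_inj_algHom_of_fg ℂ A
  rcases Nat.eq_zero_or_pos d with rfl | hd
  · let _ : Algebra (MvPolynomial (Fin 0) ℂ) A := g.toRingHom.toAlgebra
    have : Algebra.IsIntegral (MvPolynomial (Fin 0) ℂ) A := ⟨gint⟩
    have hF : IsField (MvPolynomial (Fin 0) ℂ) :=
      (isEmptyAlgEquiv ℂ (Fin 0)).toMulEquiv.isField (Field.toIsField ℂ)
    have hA : IsField A := isField_of_isIntegral_of_isField' hF
    exact (Ideal.Quotient.maximal_of_isField P hA).eq_of_le (Ideal.IsPrime.ne_top inferInstance) hle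
  let π : MvPolynomial (Fin n) ℂ →ₐ[ℂ] A := Ideal.Quotient.mkₐ ℂ P
  have hπ : Function.Surjective π := Ideal.Quotient.mkₐ_surjective ℂ P
  have hpt : ∀ w : Fin n → ℂ, (∀ f ∈ P, eval w f = 0) → ∃ y : A →ₐ[ℂ] ℂ, ∀ f, y (π f) = eval w f :=
    fun w hw => ⟨Ideal.Quotient.liftₐ P (aeval w) (fun f hf => by
      rw [aeval_eq_eval]; exact hw f hf), fun f => by
        change aeval w f = _
        rw [aeval_eq_eval]⟩
  have hcoord : ∀ (y : A →ₐ[ℂ] ℂ) (f), y (π f) = eval (fun j => y (π (X j))) f := fun y f => by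
    have : y.comp π = aeval fun j => y (π (X j)) := by ext j; simp
    rw [← AlgHom.comp_apply, this, aeval_eq_eval]
  have hzero : ∀ (y : A →ₐ[ℂ] ℂ), ∀ f ∈ P, eval (fun j => y (π (X j))) f = 0 := fun y f hf => by
    rw [← hcoord, show π f = 0 from Ideal.Quotient.eq_zero_iff_mem.2 hf, map_zero]
  obtain ⟨x, hx⟩ := hpt p fun f hf => hle hf
  let β₀ : Fin d → ℂ := fun i => x (g (X i))
  have hxg : x.comp g = aeval β₀ := by ext i; simp [β₀]
  -- `G` singles out `x` in its fibre, so a limit point over `β₀` with `G = 0` must be `x`.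
  obtain ⟨G, hxG, hG⟩ := exists_separating_element (x := x) (finite_points_over g gint β₀)
  obtain ⟨m, hm, b, hb, hlift⟩ := exists_point_over_norm_le g ginj gint x G hxG
  -- A sequence tending to `β₀` and, since `d > 0`, never equal to it: points over `β k` differ from
  -- `x`.
  let β : ℕ → Fin d → ℂ := fun k i => β₀ i + 1 / ((k : ℂ) + 1)
  have hβ : Tendsto β atTop (𝓝 β₀) := by
    rw [tendsto_pi_nhds]
    intro i
    simpa [β] using
      (tendsto_const_nhds (x := β₀ i)).add (tendsto_one_div_add_atTop_nhds_zero_nat (𝕜 := ℂ))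
  have hβball : ∀ k, β k ∈ Metric.closedBall β₀ 1 := fun k => by
    rw [Metric.mem_closedBall, dist_pi_le_iff zero_le_one]
    intro i
    have h1 : (1 : ℝ) ≤ ‖((k : ℂ) + 1)‖ := by
      have : ((k : ℂ) + 1) = ((k + 1 : ℕ) : ℂ) := by push_cast; rfl
      rw [this, Complex.norm_natCast]
      exact_mod_cast Nat.le_add_left 1 k
    rw [dist_eq_norm, add_sub_cancel_left, norm_div, norm_one]
    exact div_le_one_of_le₀ h1 (norm_nonneg _)
  choose y hy hyG using fun k => hlift (β k)
  choose K hK using fun j => exists_norm_le_of_isIntegral g gint (π (X j)) β₀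
  let w : ℕ → Fin n → ℂ := fun k j => y k (π (X j))
  obtain ⟨v, -, φ, hφ, hlim⟩ := tendsto_subseq_of_bounded
    (Metric.isBounded_closedBall (x := (0 : Fin n → ℂ)) (r := ∑ j, |K j|)) (x := w) (fun k => by
      rw [mem_closedBall_zero_iff, pi_norm_le_iff_of_nonneg (Finset.sum_nonneg fun _ _ => abs_nonneg _)]
      intro j
      exact ((hK j _ (hβball k) (y k) (hy k)).trans (le_abs_self _)).trans
        (Finset.single_le_sum (f := fun j => |K j|) (fun _ _ => abs_nonneg _) (Finset.mem_univ j)))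
  have hev : ∀ f, Tendsto (fun k => y (φ k) (π f)) atTop (𝓝 (eval v f)) := fun f => by
    have h1 := ((continuous_eval f).tendsto v).comp hlim
    refine h1.congr fun k => ?_
    exact (hcoord (y (φ k)) f).symm
  obtain ⟨z, hz⟩ := hpt v fun f hf => by
    refine tendsto_nhds_unique (hev f) ?_
    rw [show π f = 0 from Ideal.Quotient.eq_zero_iff_mem.2 hf]
    simp
  have hev' : ∀ a, Tendsto (fun k => y (φ k) a) atTop (𝓝 (z a)) := fun a => by
    obtain ⟨f, rfl⟩ := hπ a
    rw [hz]; exact hev f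
  have hβφ := hβ.comp hφ.tendsto_atTop
  have hzg : z.comp g = aeval β₀ := by
    ext i
    refine tendsto_nhds_unique (hev' (g (X i))) ?_
    rw [aeval_X]
    refine ((tendsto_pi_nhds.1 hβφ) i).congr fun k => ?_
    have := DFunLike.congr_fun (hy (φ k)) (X i)
    simpa using this.symm
  have hbβ₀ : eval β₀ b = 0 := by
    rw [← hb, ← AlgHom.comp_apply, hxg, aeval_eq_eval]
  have hzG : z G = 0 := by
    have h1 : Tendsto (fun k => ‖y (φ k) G‖ ^ m) atTop (𝓝 (‖z G‖ ^ m)) := (hev' G).norm.pow m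
    have h2 : Tendsto (fun k => ‖eval (β (φ k)) b‖) atTop (𝓝 ‖eval β₀ b‖) :=
      (((continuous_eval b).tendsto β₀).comp hβφ).norm
    have h3 := le_of_tendsto_of_tendsto' h1 h2 fun k => hyG (φ k)
    rw [hbβ₀, norm_zero] at h3
    exact norm_eq_zero.1 (pow_eq_zero_iff hm |>.1 (le_antisymm h3 (by positivity)))
  have hzx : z = x := hG z hzg hzG
  have hvp : v = p := by
    funext j
    have h1 := hz (X j)
    rw [hzx, hx] at h1
    simpa using h1.symm
  rw [hvp] at hlim
  -- A lifted point this close to `p` equals `p` by isolation, so it lies over `β₀` as well as over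
  -- `β (φ k)`.
  obtain ⟨k, hk⟩ := (Metric.tendsto_nhds.1 hlim ε hε).exists
  have hwp : w (φ k) = p := hiso _ (by rw [← dist_eq_norm]; exact hk) (hzero (y (φ k)))
  have hyx : y (φ k) = x := by
    refine AlgHom.ext fun a => ?_
    obtain ⟨f, rfl⟩ := hπ a
    rw [hcoord, hx]
    exact congrArg (fun u => eval u f) hwp
  have h1 := DFunLike.congr_fun (hy (φ k)) (X ⟨0, hd⟩)
  rw [hyx, hxg, aeval_X, aeval_X] at h1
  have h2 : (1 : ℂ) / ((φ k : ℂ) + 1) = 0 := by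
    have : β (φ k) ⟨0, hd⟩ = β₀ ⟨0, hd⟩ + 1 / ((φ k : ℂ) + 1) := rfl
    rw [← h1] at this
    simpa using this
  exact absurd h2 (one_div_ne_zero (Nat.cast_add_one_ne_zero (φ k)))

theorem IsIsolatedZero.eq_pointIdeal {n : ℕ} {ι : Type*} {F : ι → MvPolynomial (Fin n) ℂ}
    {p : Fin n → ℂ} (hp : IsIsolatedZero F p) (P : Ideal (MvPolynomial (Fin n) ℂ)) (hP : P.IsPrime)
    (hle : P ≤ pointIdeal p) (hF : ∀ i, F i ∈ P) : P = pointIdeal p := by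
  obtain ⟨ε, hε, h⟩ := hp
  refine eq_pointIdeal_of_isolated p P hle ε hε fun y hy hyP => ?_
  have : y ∈ ({p} : Set (Fin n → ℂ)) := h ▸ ⟨hy, fun i => hyP _ (hF i)⟩
  exact this

end IsolatedZeros

/-! ### The augmented system and the drop in multiplicity -/

section Deflation

open scoped PowerSeries
open IsLocalRing

theorem Matrix.exists_mul_eq_one_of_rank_eq {s n : ℕ} (A : Matrix (Fin s) (Fin n) ℂ)
    (h : A.rank = s) : ∃ N : Matrix (Fin n) (Fin s) ℂ, A * N = 1 := by
  have hsurj : LinearMap.range A.mulVecLin = ⊤ :=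
    Submodule.eq_top_of_finrank_eq (by rw [Module.finrank_fin_fun]; exact h)
  choose v hv using fun k => LinearMap.range_eq_top.1 hsurj (Pi.single k 1)
  refine ⟨(Matrix.of v).transpose, ?_⟩
  ext i k
  have := congrFun (hv k) i
  rw [Matrix.mulVecLin_apply] at this
  rw [Matrix.mul_apply, Matrix.one_apply, ← Pi.single_apply, ← this]
  rfl

/-- If the first `s` rows of the Jacobian matrix have full rank and span the row space, then
the row with index `s` is a unique combination of them. -/
theorem existsUnique_jacobianAt_combination {n s : ℕ} (hs : s < n)
    (F : Fin n → MvPolynomial (Fin n) ℂ) (p : Fin n → ℂ)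
    (hrank_s : (jacobianAt (fun i : Fin s => F (Fin.castLE hs.le i)) p).rank = s)
    (hrank : (jacobianAt F p).rank = s) :
    ∃! α : Fin s → ℂ, ∀ j, ∑ i, α i * eval p (pderiv j (F (Fin.castLE hs.le i))) +
      eval p (pderiv j (F ⟨s, hs⟩)) = 0 := by
  set A := jacobianAt (fun i : Fin s => F (Fin.castLE hs.le i)) p with hA
  have hle : Submodule.span ℂ (Set.range A.row) ≤
      Submodule.span ℂ (Set.range (jacobianAt F p).row) := by
    refine Submodule.span_mono ?_
    rintro _ ⟨i, rfl⟩
    exact ⟨Fin.castLE hs.le i, rfl⟩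
  have heq := Submodule.eq_of_le_of_finrank_eq hle
    (by rw [← Matrix.rank_eq_finrank_span_row, ← Matrix.rank_eq_finrank_span_row, hrank_s, hrank])
  have hmem : (jacobianAt F p).row ⟨s, hs⟩ ∈ Submodule.span ℂ (Set.range A.row) :=
    heq ▸ Submodule.subset_span ⟨_, rfl⟩
  obtain ⟨c, hc⟩ := (Submodule.mem_span_range_iff_exists_fun ℂ).1 hmem
  have hc' : ∀ j, ∑ i, c i * eval p (pderiv j (F (Fin.castLE hs.le i))) =
      eval p (pderiv j (F ⟨s, hs⟩)) := fun j => by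
    have := congrFun hc j
    simpa [Finset.sum_apply, hA, jacobianAt, Matrix.row] using this
  obtain ⟨N, hN⟩ := A.exists_mul_eq_one_of_rank_eq hrank_s
  refine ⟨-c, fun j => ?_, fun α hα => ?_⟩
  · simp only [Pi.neg_apply, neg_mul, Finset.sum_neg_distrib]
    rw [hc', neg_add_cancel]
  · have h1 : Matrix.vecMul (α + c) A = 0 := by
      funext j
      have h2 := hα j
      rw [← hc' j, ← Finset.sum_add_distrib] at h2
      simpa [Matrix.vecMul, dotProduct, hA, jacobianAt, add_mul] using h2
    have h2 := congrArg (fun u => Matrix.vecMul u N) h1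
    simp only [Matrix.vecMul_vecMul, hN, Matrix.vecMul_one, Matrix.zero_vecMul] at h2
    exact eq_neg_of_add_eq_zero_left h2

theorem eval_augmentedSystem_inr {n s : ℕ} (hs : s < n) (F : Fin n → MvPolynomial (Fin n) ℂ)
    (p : Fin n → ℂ) (α : Fin s → ℂ) (j : Fin n) :
    eval (Sum.elim p α) (augmentedSystem hs F (Sum.inr j)) =
      ∑ i, α i * eval p (pderiv j (F (Fin.castLE hs.le i))) + eval p (pderiv j (F ⟨s, hs⟩)) := by
  simp [augmentedSystem, eval_rename]

theorem IsIsolatedZero.mem_zeroSet {σ ι : Type*} [Fintype σ] {F : ι → MvPolynomial σ ℂ}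
    {p : σ → ℂ} (hp : IsIsolatedZero F p) : p ∈ zeroSet F := by
  obtain ⟨ε, -, h⟩ := hp
  have : p ∈ ({p} : Set (σ → ℂ)) := rfl
  rw [← h] at this
  exact this.2

theorem isIsolatedZero_augmentedSystem_iff {n s : ℕ} (hs : s < n)
    (F : Fin n → MvPolynomial (Fin n) ℂ) (p : Fin n → ℂ) (hp : IsIsolatedZero F p)
    (hα : ∃! α : Fin s → ℂ, ∀ j, ∑ i, α i * eval p (pderiv j (F (Fin.castLE hs.le i))) +
      eval p (pderiv j (F ⟨s, hs⟩)) = 0) (α : Fin s → ℂ) :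
    IsIsolatedZero (augmentedSystem hs F) (Sum.elim p α) ↔
      ∀ j, ∑ i, α i * eval p (pderiv j (F (Fin.castLE hs.le i))) +
        eval p (pderiv j (F ⟨s, hs⟩)) = 0 := by
  constructor
  · intro h j
    rw [← eval_augmentedSystem_inr]
    exact h.mem_zeroSet (Sum.inr j)
  · intro h
    have hp0 := hp.mem_zeroSet
    obtain ⟨ε, hε, hiso⟩ := hp
    -- The same radius serves, because projecting to `x` does not increase the sup norm.
    refine ⟨ε, hε, Set.eq_singleton_iff_unique_mem.2 ⟨⟨by simpa using hε, ?_⟩, ?_⟩⟩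
    · rintro (i | j)
      · simpa [augmentedSystem, eval_rename] using hp0 i
      · rw [eval_augmentedSystem_inr]; exact h j
    · rintro y ⟨hy, hy0⟩
      obtain ⟨x, β, rfl⟩ : ∃ x β, y = Sum.elim x β :=
        ⟨y ∘ Sum.inl, y ∘ Sum.inr, (Sum.elim_comp_inl_inr y).symm⟩
      have hx : x ∈ ({p} : Set (Fin n → ℂ)) := by
        rw [← hiso]
        have hle : ‖x - p‖ ≤ ‖Sum.elim x β - Sum.elim p α‖ :=
          (pi_norm_le_iff_of_nonneg (norm_nonneg _)).2 fun j =>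
            norm_le_pi_norm (Sum.elim x β - Sum.elim p α) (Sum.inl j)
        exact ⟨hle.trans_lt hy, fun i => by
          simpa [augmentedSystem, eval_rename] using hy0 (Sum.inl i)⟩
      obtain rfl : x = p := hx
      have hβ : ∀ j, ∑ i, β i * eval x (pderiv j (F (Fin.castLE hs.le i))) +
          eval x (pderiv j (F ⟨s, hs⟩)) = 0 := fun j => by
        rw [← eval_augmentedSystem_inr]; exact hy0 (Sum.inr j)
      rw [hα.unique hβ h]

theorem localIdeal_le_maximalIdeal {σ ι : Type*} {F : ι → MvPolynomial σ ℂ} {p : σ → ℂ}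
    (hp : p ∈ zeroSet F) : localIdeal F p ≤ maximalIdeal (LocalRingAt p) := by
  rw [localIdeal, Ideal.map_span, Ideal.span_le]
  rintro _ ⟨_, ⟨i, rfl⟩, rfl⟩
  exact (IsLocalization.AtPrime.to_map_mem_maximal_iff _ (pointIdeal p) _).2 (hp i)

theorem pointIdeal_comp {σ τ : Type*} (e : σ → τ) (q : τ → ℂ) :
    pointIdeal (q ∘ e) = (pointIdeal q).comap (rename e : MvPolynomial σ ℂ →ₐ[ℂ] _) := by
  ext f; simp [RingHom.mem_ker, Ideal.mem_comap, eval_rename]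

/-- The homomorphism of local rings induced by a projection of affine spaces. -/
noncomputable def localRename {σ τ : Type*} (e : σ → τ) (q : τ → ℂ) :
    LocalRingAt (q ∘ e) →ₐ[ℂ] LocalRingAt q :=
  Localization.localAlgHom _ _ (rename e) (pointIdeal_comp e q)

theorem localRename_algebraMap {σ τ : Type*} (e : σ → τ) (q : τ → ℂ) (f : MvPolynomial σ ℂ) :
    localRename e q (algebraMap _ _ f) = algebraMap _ _ (rename e f) :=
  Localization.localRingHom_to_map _ _ _ (pointIdeal_comp e q) _

theorem localRename_mem_maximalIdeal {σ τ : Type*} (e : σ → τ) (q : τ → ℂ)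
    {r : LocalRingAt (q ∘ e)} (hr : r ∈ maximalIdeal (LocalRingAt (q ∘ e))) :
    localRename e q r ∈ maximalIdeal (LocalRingAt q) := by
  have h : IsLocalHom (Localization.localRingHom (pointIdeal (q ∘ e)) (pointIdeal q)
    (rename e : MvPolynomial σ ℂ →ₐ[ℂ] MvPolynomial τ ℂ).toRingHom (pointIdeal_comp e q)) :=
    Localization.isLocalHom_localRingHom _ _ _ _
  exact fun hu => hr (h.map_nonunit _ hu)

theorem RingHom.map_mul_eq_of_mul_eq_one {R B : Type*} [CommRing R] [CommRing B] (ψ : R →+* B)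
    {v w r : R} {b : B} (hw : w * v = 1) (h : b * ψ v = ψ r) : ψ (w * r) = b := by
  rw [map_mul, ← h, mul_left_comm, ← map_mul, hw, map_one, mul_one]

/-- A quotient of the local ring at `q` is generated by the local ring at a projection of `q` as
soon as all coordinate functions come from there. -/
theorem mk_comp_localRename_surjective {σ τ : Type*} (e : σ → τ) (q : τ → ℂ)
    (I : Ideal (LocalRingAt q)) (hI : I ≤ maximalIdeal (LocalRingAt q))
    (hX : ∀ t, ∃ r, Ideal.Quotient.mk I (localRename e q r) =
      Ideal.Quotient.mk I (algebraMap (MvPolynomial τ ℂ) _ (X t))) :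
    Function.Surjective ((Ideal.Quotient.mk I).comp (localRename e q).toRingHom) := by
  set ψ := (Ideal.Quotient.mk I).comp (localRename e q).toRingHom with hψ
  have hψ' : ∀ r, ψ r = Ideal.Quotient.mk I (localRename e q r) := fun _ => rfl
  have hpoly : ∀ f : MvPolynomial τ ℂ, ∃ r, ψ r = Ideal.Quotient.mk I (algebraMap _ _ f) := by
    intro f
    induction f using MvPolynomial.induction_on with
    | C c =>
      refine ⟨algebraMap (MvPolynomial σ ℂ) _ (C c), ?_⟩
      rw [hψ', localRename_algebraMap, rename_C]
    | add f g hf hg =>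
      obtain ⟨r, hr⟩ := hf
      obtain ⟨r', hr'⟩ := hg
      exact ⟨r + r', by rw [map_add, hr, hr', map_add, map_add]⟩
    | mul_X f t hf =>
      obtain ⟨r, hr⟩ := hf
      obtain ⟨r', hr'⟩ := hX t
      rw [← hψ'] at hr'
      exact ⟨r * r', by rw [map_mul, hr, hr', map_mul, map_mul]⟩
  intro b
  obtain ⟨b, rfl⟩ := Ideal.Quotient.mk_surjective b
  obtain ⟨f, u, rfl⟩ := IsLocalization.exists_mk'_eq (pointIdeal q).primeCompl b
  obtain ⟨r, hr⟩ := hpoly f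
  obtain ⟨v, hv⟩ := hpoly u
  -- Otherwise `u`, congruent to the image of `v` modulo `I`, would vanish at `q`.
  have hvu : IsUnit v := by
    by_contra hv'
    have h1 := localRename_mem_maximalIdeal e q ((mem_maximalIdeal v).2 hv')
    have h2 : localRename e q v - algebraMap _ _ (u : MvPolynomial τ ℂ) ∈ I :=
      Ideal.Quotient.eq.1 hv
    have h3 := sub_mem h1 (hI h2)
    rw [sub_sub_cancel, IsLocalization.AtPrime.to_map_mem_maximal_iff _ (pointIdeal q)] at h3
    exact u.2 h3
  obtain ⟨w, hw⟩ := hvu.exists_left_inv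
  have h1 := congrArg (Ideal.Quotient.mk I) (IsLocalization.mk'_spec (LocalRingAt q) f u)
  rw [map_mul, ← hv, ← hr] at h1
  have h2 := RingHom.map_mul_eq_of_mul_eq_one (R := LocalRingAt (q ∘ e)) (B := LocalRingAt q ⧸ I) ψ
    hw h1
  exact ⟨w * r, h2⟩

theorem mk_localIdeal_augmentedSystem {n s : ℕ} (hs : s < n) (F : Fin n → MvPolynomial (Fin n) ℂ)
    (q : Fin n ⊕ Fin s → ℂ) (j : Fin n) :
    ∑ i, Ideal.Quotient.mk (localIdeal (augmentedSystem hs F) q) (algebraMap (MvPolynomial (Fin n ⊕ Fin s) ℂ) _ (X (Sum.inr i))) *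
        Ideal.Quotient.mk (localIdeal (augmentedSystem hs F) q)
          (localRename Sum.inl q (algebraMap _ _ (pderiv j (F (Fin.castLE hs.le i))))) +
      Ideal.Quotient.mk (localIdeal (augmentedSystem hs F) q)
        (localRename Sum.inl q (algebraMap _ _ (pderiv j (F ⟨s, hs⟩)))) = 0 := by
  have h : Ideal.Quotient.mk (localIdeal (augmentedSystem hs F) q)
      (algebraMap _ _ (augmentedSystem hs F (Sum.inr j))) = 0 :=
    Ideal.Quotient.eq_zero_iff_mem.2
      (Ideal.mem_map_of_mem _ (Ideal.subset_span ⟨Sum.inr j, rfl⟩))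
  simp only [localRename_algebraMap]
  have hG : augmentedSystem hs F (Sum.inr j) =
      (∑ i : Fin s, X (Sum.inr i) * rename Sum.inl (pderiv j (F (Fin.castLE hs.le i)))) +
        rename Sum.inl (pderiv j (F ⟨s, hs⟩)) := rfl
  rw [hG] at h
  rw [← h]
  simp only [map_add, map_sum, map_mul]

/-- Multiply by `N` to get a square system, then by the adjugate. An arbitrary `N` avoids selecting
a minor of `P`. -/
theorem Matrix.exists_map_det_mul_eq_of_vecMul_map_eq {T S m l : Type*} [CommRing T] [CommRing S]
    [Fintype m] [DecidableEq m] [Fintype l] (ρ : T →+* S) (P : Matrix m l T) (N : Matrix l m T)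
    (v : l → T) (A : m → S) (h : Matrix.vecMul A (P.map ρ) = -(ρ ∘ v)) (i : m) :
    ∃ z, A i * ρ (P * N).det = ρ z := by
  have hρ : ∀ {m' : Type _} (v : m → T) (B : Matrix m m' T),
      Matrix.vecMul (ρ ∘ v) (B.map ρ) = ρ ∘ Matrix.vecMul v B := fun v B => by
    funext k; simp [Matrix.vecMul, dotProduct]
  have h2 : Matrix.vecMul A ((P * N).map ρ) = -(ρ ∘ Matrix.vecMul v N) := by
    rw [Matrix.map_mul, ← Matrix.vecMul_vecMul, h, Matrix.neg_vecMul]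
    congr 1
    funext k
    simp [Matrix.vecMul, dotProduct]
  have h4 := congrArg (fun u => Matrix.vecMul u ((P * N).adjugate.map ρ) i) h2
  simp only [Matrix.vecMul_vecMul, ← Matrix.map_mul, Matrix.mul_adjugate] at h4
  have h5 : ((P * N).det • (1 : Matrix m m T)).map ρ = ρ (P * N).det • (1 : Matrix m m S) := by
    ext a b
    by_cases hab : a = b <;> simp [hab]
  rw [h5, Matrix.vecMul_smul, Matrix.vecMul_one, Matrix.neg_vecMul, hρ, Pi.neg_apply] at h4
  exact ⟨-(Matrix.vecMul (Matrix.vecMul v N) (P * N).adjugate i), by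
    rw [map_neg, mul_comm]; exact h4⟩

/-- Cramer's rule for the multipliers of the augmented system. -/
theorem exists_cramer {n s : ℕ} (hs : s < n) (F : Fin n → MvPolynomial (Fin n) ℂ) (p : Fin n → ℂ)
    (hrank_s : (jacobianAt (fun i : Fin s => F (Fin.castLE hs.le i)) p).rank = s)
    {S : Type*} [CommRing S] (ρ : MvPolynomial (Fin n) ℂ →+* S) (A : Fin s → S)
    (h : ∀ j, ∑ i, A i * ρ (pderiv j (F (Fin.castLE hs.le i))) + ρ (pderiv j (F ⟨s, hs⟩)) = 0)
    (i : Fin s) : ∃ D z : MvPolynomial (Fin n) ℂ, eval p D ≠ 0 ∧ A i * ρ D = ρ z := by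
  obtain ⟨N, hN⟩ := Matrix.exists_mul_eq_one_of_rank_eq _ hrank_s
  let P : Matrix (Fin s) (Fin n) (MvPolynomial (Fin n) ℂ) :=
    Matrix.of fun i j => pderiv j (F (Fin.castLE hs.le i))
  -- With the constant right inverse of the Jacobian at `p`, the determinant of `P * N'` takes the
  -- value `1` at `p`.
  let N' : Matrix (Fin n) (Fin s) (MvPolynomial (Fin n) ℂ) := N.map C
  obtain ⟨z, hz⟩ := Matrix.exists_map_det_mul_eq_of_vecMul_map_eq ρ P N'
    (fun j => pderiv j (F ⟨s, hs⟩)) A (funext fun j => eq_neg_of_add_eq_zero_left (h j)) i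
  refine ⟨_, z, ?_, hz⟩
  have : (eval p).mapMatrix (P * N') = 1 := by
    rw [← hN]
    ext i k
    rw [RingHom.mapMatrix_apply, Matrix.map_apply, Matrix.mul_apply, Matrix.mul_apply, map_sum]
    exact Finset.sum_congr rfl fun j _ => by
      rw [map_mul]
      change eval p (P i j) * eval p (C (N j k)) = _
      rw [eval_C]; rfl
  rw [RingHom.map_det, this, Matrix.det_one]
  exact one_ne_zero

theorem mk_comp_localRename_augmentedSystem_surjective {n s : ℕ} (hs : s < n)
    (F : Fin n → MvPolynomial (Fin n) ℂ)
    (q : Fin n ⊕ Fin s → ℂ) (hq : q ∈ zeroSet (augmentedSystem hs F))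
    (hrank_s : (jacobianAt (fun i : Fin s => F (Fin.castLE hs.le i)) (q ∘ Sum.inl)).rank = s) :
    Function.Surjective ((Ideal.Quotient.mk (localIdeal (augmentedSystem hs F) q)).comp
      (localRename Sum.inl q).toRingHom) := by
  refine mk_comp_localRename_surjective _ _ _ (localIdeal_le_maximalIdeal hq) ?_
  rintro (j | i)
  · exact ⟨algebraMap _ _ (X j), by rw [localRename_algebraMap, rename_X]⟩
  let ψ := (Ideal.Quotient.mk (localIdeal (augmentedSystem hs F) q)).comp
    (localRename Sum.inl q).toRingHom
  obtain ⟨D, z, hD, h⟩ := exists_cramer hs F (q ∘ Sum.inl) hrank_s (ψ.comp (algebraMap _ _))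
    (fun i => Ideal.Quotient.mk (localIdeal (augmentedSystem hs F) q)
      (algebraMap (MvPolynomial (Fin n ⊕ Fin s) ℂ) _ (X (Sum.inr i))))
    (mk_localIdeal_augmentedSystem hs F q) i
  obtain ⟨w, hw⟩ := (IsLocalization.map_units (LocalRingAt (q ∘ Sum.inl))
    (⟨D, hD⟩ : (pointIdeal (q ∘ Sum.inl)).primeCompl)).exists_left_inv
  have h2 := RingHom.map_mul_eq_of_mul_eq_one (R := LocalRingAt (q ∘ Sum.inl))
    (B := LocalRingAt q ⧸ localIdeal (augmentedSystem hs F) q) ψ hw h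
  exact ⟨_, h2⟩

theorem derivative_algHom_powerSeries {n : ℕ} (θ : MvPolynomial (Fin n) ℂ →ₐ[ℂ] ℂ⟦X⟧)
    (f : MvPolynomial (Fin n) ℂ) :
    PowerSeries.derivative ℂ (θ f) =
      ∑ j, θ (pderiv j f) * PowerSeries.derivative ℂ (θ (X j)) := by
  induction f using MvPolynomial.induction_on with
  | C c =>
    rw [← algebraMap_eq, AlgHom.commutes, Derivation.map_algebraMap]
    simp [algebraMap_eq]
  | add f g hf hg => simp [hf, hg, add_mul, Finset.sum_add_distrib]
  | mul_X f t hf =>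
    have h1 : ∀ j, θ (pderiv j (f * X t)) * PowerSeries.derivative ℂ (θ (X j)) =
        θ (X t) * (θ (pderiv j f) * PowerSeries.derivative ℂ (θ (X j))) +
          (if j = t then θ f * PowerSeries.derivative ℂ (θ (X t)) else 0) := by
      intro j
      rw [Derivation.leibniz, pderiv_X]
      by_cases hj : j = t
      · subst hj; simp; ring
      · simp [hj, Ne.symm hj]; ring
    simp only [h1, Finset.sum_add_distrib, ← Finset.mul_sum, ← hf]
    simp
    ring

/-- In characteristic zero, differentiation lowers a positive finite order by one. -/
theorem PowerSeries.eq_zero_of_dvd_derivative {u : ℂ⟦X⟧} (h0 : PowerSeries.constantCoeff u = 0)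
    (h : u ∣ PowerSeries.derivative ℂ u) : u = 0 := by
  obtain ⟨v, hv⟩ := h
  ext k
  rw [map_zero]
  induction k using Nat.strong_induction_on with
  | _ k ih =>
    cases k with
    | zero => simpa using h0
    | succ k =>
      have h1 := congrArg (PowerSeries.coeff k) hv
      rw [PowerSeries.coeff_derivative, PowerSeries.coeff_mul, Finset.sum_eq_zero] at h1
      · exact (mul_eq_zero.1 h1).resolve_right (Nat.cast_add_one_ne_zero k)
      · intro x hx
        have := Finset.HasAntidiagonal.mem_antidiagonal.1 hx
        rw [ih x.1 (by omega), zero_mul]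

/-- Subtracting a nonzero constant term from `x` would give a unit whose image has no constant term.
-/
theorem constantCoeff_eq_zero_of_mem_maximalIdeal {R : Type*} [CommRing R] [IsLocalRing R]
    [Algebra ℂ R] (Φ : R →ₐ[ℂ] ℂ⟦X⟧) {x : R} (hx : x ∈ maximalIdeal R) :
    PowerSeries.constantCoeff (Φ x) = 0 := by
  by_contra hne
  set e := PowerSeries.constantCoeff (Φ x) with he
  have hu : IsUnit (x - algebraMap ℂ R e) := by
    by_contra hnu
    have h1 := sub_mem hx ((mem_maximalIdeal _).2 hnu)
    rw [sub_sub_cancel] at h1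
    exact h1 ((isUnit_iff_ne_zero.2 hne).map (algebraMap ℂ R))
  have h2 := (hu.map Φ).map PowerSeries.constantCoeff
  rw [map_sub, AlgHom.commutes, map_sub, ← he] at h2
  simp at h2

/-- Multipliers for which the combined gradient lies in the local ideal of the system do not
exist when this ideal is primary to the maximal ideal. -/
theorem not_forall_gradient_mem_localIdeal {n s : ℕ} (hs : s < n)
    (F : Fin n → MvPolynomial (Fin n) ℂ) (p : Fin n → ℂ) (hp : p ∈ zeroSet F) {N : ℕ}
    (hN : maximalIdeal (LocalRingAt p) ^ N ≤ localIdeal F p) (a : Fin s → LocalRingAt p) :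
    ¬ ∀ j, ∑ i, a i * algebraMap _ _ (pderiv j (F (Fin.castLE hs.le i))) +
      algebraMap _ _ (pderiv j (F ⟨s, hs⟩)) ∈ localIdeal F p := by
  intro hg
  have hFm : ∀ i, algebraMap (MvPolynomial (Fin n) ℂ) (LocalRingAt p) (F i) ∈
      maximalIdeal (LocalRingAt p) := fun i =>
    (IsLocalization.AtPrime.to_map_mem_maximal_iff _ (pointIdeal p) _).2 (hp i)
  let T : Finset (Fin n) := Finset.univ.erase ⟨s, hs⟩
  have hT : T.card < n := by
    rw [Finset.card_erase_of_mem (Finset.mem_univ _), Finset.card_fin]; omega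
  obtain ⟨Φ, hΦ, b, hb, hΦb⟩ := exists_arc_of_card_lt p
    ((fun i => algebraMap (MvPolynomial (Fin n) ℂ) (LocalRingAt p) (F i)) '' (T : Set (Fin n)))
    (T.finite_toSet.image _)
    ((Set.ncard_image_le T.finite_toSet).trans_lt (by rwa [Set.ncard_coe_finset]))
    (by rintro _ ⟨i, -, rfl⟩; exact hFm i)
  let θ : MvPolynomial (Fin n) ℂ →ₐ[ℂ] ℂ⟦X⟧ :=
    Φ.comp (IsScalarTower.toAlgHom ℂ (MvPolynomial (Fin n) ℂ) (LocalRingAt p))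
  have hθ : ∀ f, Φ (algebraMap _ _ f) = θ f := fun _ => rfl
  have hθF : ∀ i, i ≠ ⟨s, hs⟩ → θ (F i) = 0 := fun i hi =>
    hΦ _ ⟨i, by simpa [T] using hi, rfl⟩
  set u := θ (F ⟨s, hs⟩) with hu
  have hIu : localIdeal F p ≤ (Ideal.span {u}).comap Φ := by
    rw [localIdeal, Ideal.map_span, Ideal.span_le]
    rintro _ ⟨_, ⟨i, rfl⟩, rfl⟩
    change Φ _ ∈ Ideal.span {u}
    rw [hθ]
    by_cases hi : i = ⟨s, hs⟩
    · rw [hi]; exact Ideal.mem_span_singleton_self _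
    · rw [hθF i hi]; exact zero_mem _
  -- The terms `a i` may be added to the chain rule for `u` at no cost, since each `f_i` with `i ≤
  -- s` is zero along the arc. The coefficients then lie in the image of `localIdeal F p`, hence in
  -- `(u)`.
  have hdu : u ∣ PowerSeries.derivative ℂ u := by
    have hk : ∀ i : Fin s, ∑ j, θ (pderiv j (F (Fin.castLE hs.le i))) *
        PowerSeries.derivative ℂ (θ (X j)) = 0 := fun i => by
      rw [← derivative_algHom_powerSeries, hθF, map_zero]
      intro h
      have := congrArg Fin.val h
      simp at this
      omega
    have h1 : PowerSeries.derivative ℂ u = ∑ j, Φ (∑ i, a i *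
        algebraMap _ _ (pderiv j (F (Fin.castLE hs.le i))) +
        algebraMap _ _ (pderiv j (F ⟨s, hs⟩))) * PowerSeries.derivative ℂ (θ (X j)) := by
      simp only [map_add, map_sum, map_mul, hθ, add_mul, Finset.sum_add_distrib, Finset.sum_mul]
      rw [Finset.sum_comm]
      simp only [mul_assoc, ← Finset.mul_sum, hk, mul_zero, Finset.sum_const_zero, zero_add]
      exact derivative_algHom_powerSeries θ _
    rw [h1]
    exact Finset.dvd_sum fun j _ => Dvd.dvd.mul_right (Ideal.mem_span_singleton.1 (hIu (hg j))) _
  have hu0 : u = 0 := PowerSeries.eq_zero_of_dvd_derivative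
    (constantCoeff_eq_zero_of_mem_maximalIdeal Φ (hFm _)) hdu
  have h1 := hIu (hN (Ideal.pow_mem_pow hb N))
  rw [Ideal.mem_comap, hu0, Ideal.mem_span_singleton, zero_dvd_iff, map_pow] at h1
  exact hΦb (eq_zero_of_pow_eq_zero h1)

theorem multiplicityAt_eq_finrank {σ ι : Type*} (F : ι → MvPolynomial σ ℂ) (p : σ → ℂ)
    [Module.Finite ℂ (LocalRingAt p ⧸ localIdeal F p)] :
    multiplicityAt F p = Module.finrank ℂ (LocalRingAt p ⧸ localIdeal F p) := by
  rw [multiplicityAt, ← Module.finrank_eq_rank, Cardinal.toENat_nat]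

theorem multiplicityAt_augmentedSystem_lt {n s : ℕ} (hs : s < n)
    (F : Fin n → MvPolynomial (Fin n) ℂ) (q : Fin n ⊕ Fin s → ℂ)
    (hp : IsIsolatedZero F (q ∘ Sum.inl)) (hq : q ∈ zeroSet (augmentedSystem hs F))
    (hrank_s : (jacobianAt (fun i : Fin s => F (Fin.castLE hs.le i)) (q ∘ Sum.inl)).rank = s) :
    multiplicityAt (augmentedSystem hs F) q < multiplicityAt F (q ∘ Sum.inl) := by
  set p := q ∘ Sum.inl with hpq
  obtain ⟨hfin, N, hN⟩ := finite_quotient_localIdeal F p hp.eq_pointIdeal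
  have hsurj := mk_comp_localRename_augmentedSystem_surjective hs F q hq hrank_s
  have hle : localIdeal F p ≤ (localIdeal (augmentedSystem hs F) q).comap
      (localRename Sum.inl q : LocalRingAt p →ₐ[ℂ] LocalRingAt q) := by
    rw [localIdeal, Ideal.map_span, Ideal.span_le]
    rintro _ ⟨_, ⟨i, rfl⟩, rfl⟩
    change localRename Sum.inl q _ ∈ localIdeal (augmentedSystem hs F) q
    rw [localRename_algebraMap]
    exact Ideal.mem_map_of_mem _ (Ideal.subset_span ⟨Sum.inl i, rfl⟩)
  let ψ := Ideal.quotientMapₐ (localIdeal (augmentedSystem hs F) q)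
    (localRename Sum.inl q : LocalRingAt p →ₐ[ℂ] LocalRingAt q) hle
  have hψ : ∀ r, ψ (Ideal.Quotient.mk _ r) = Ideal.Quotient.mk _ (localRename Sum.inl q r) :=
    fun _ => rfl
  have hψs : Function.Surjective ψ := fun b => by
    obtain ⟨r, hr⟩ := hsurj b
    exact ⟨Ideal.Quotient.mk _ r, hr⟩
  have hfin' : Module.Finite ℂ (LocalRingAt q ⧸ localIdeal (augmentedSystem hs F) q) :=
    Module.Finite.of_surjective ψ.toLinearMap hψs
  rw [multiplicityAt_eq_finrank, multiplicityAt_eq_finrank, Nat.cast_lt]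
  refine lt_of_le_of_ne (LinearMap.finrank_le_finrank_of_surjective (f := ψ.toLinearMap) hψs)
    fun heq => ?_
  have hψi : Function.Injective ψ :=
    (LinearMap.injective_iff_surjective_of_finrank_eq_finrank (f := ψ.toLinearMap) heq.symm).2 hψs
  -- Representatives of the `α_i` in the local ring at `p`; injectivity of `ψ` carries the relations
  -- `h_j = 0` back to the quotient by `F`.
  choose a ha using fun i : Fin s => hsurj (Ideal.Quotient.mk _ (algebraMap (MvPolynomial (Fin n ⊕ Fin s) ℂ) _ (X (Sum.inr i))))
  refine not_forall_gradient_mem_localIdeal hs F p hp.mem_zeroSet hN a fun j => ?_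
  rw [← Ideal.Quotient.eq_zero_iff_mem]
  apply hψi
  rw [hψ, map_zero, ← mk_localIdeal_augmentedSystem hs F q j]
  simp only [map_add, map_sum, map_mul]
  congr 1
  refine Finset.sum_congr rfl fun i _ => ?_
  congr 1
  exact ha i

end Deflation

theorem mainTheorem3 (n s : ℕ) (hs : s < n) (F : Fin n → MvPolynomial (Fin n) ℂ)
    (p : Fin n → ℂ) (hp : IsIsolatedSingularZero F p)
    (hrank_s : (jacobianAt (fun i : Fin s => F (Fin.castLE hs.le i)) p).rank = s)
    (hrank : (jacobianAt F p).rank = s) :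
    (∃! α : Fin s → ℂ, IsIsolatedZero (augmentedSystem hs F) (Sum.elim p α)) ∧
      ∀ α : Fin s → ℂ, IsIsolatedZero (augmentedSystem hs F) (Sum.elim p α) →
        multiplicityAt (augmentedSystem hs F) (Sum.elim p α) < multiplicityAt F p := by
  have hex := existsUnique_jacobianAt_combination hs F p hrank_s hrank
  refine ⟨?_, fun α hα => ?_⟩
  · simpa only [isIsolatedZero_augmentedSystem_iff hs F p hp.1 hex] using hex
  · exact multiplicityAt_augmentedSystem_lt hs F (Sum.elim p α) hp.1 hα.mem_zeroSet hrank_s
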